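/- Let $\mathbb K\in\{\mathbb R,\mathbb C\}$ and let $\mathfrak g$ be a Hausdorff locally convex Lie algebra over $\mathbb K$ (that is, a Lie algebra whose underlying vector space is a Hausdorff locally convex space and whose bracket is jointly continuous). Put $\mathfrak g^{(1)}=\mathfrak g$ and $\mathfrak g^{(j+1)}=[\mathfrak g,\mathfrak g^{(j)}]$ for $j\ge 1$, and assume that $\mathfrak g^{(N)}\neq\{0\}=\mathfrak g^{(N+1)}$ for some integer $N\ge 1$. Let $G=(\mathfrak g,*)$ be the group whose operation $*$ is given by the Baker–Campbell–Hausdorff formula (a finite sum, since $\mathfrak g$ is nilpotent). Let $\mathcal C(\mathfrak g,\mathbb K)$ be the space of continuous functions $\mathfrak g\to\mathbb K$ with the topology of uniform convergence on bounded sets, let $\mathcal P_N(\mathfrak g,\mathbb K)\subseteq\mathcal C(\mathfrak g,\mathbb K)$ be the space of continuous polynomial functions of degree $\le N$ (sums of restrictions to the diagonal of continuous $j$-linear forms, $0\le j\le N$), and let $\mathfrak g^*$ be the space of continuous linear functionals on $\mathfrak g$. For $x,y\in\mathfrak g$ and $\phi\in\mathcal C(\mathfrak g,\mathbb K)$ put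 $$(\lambda(x)\phi)(y)=\phi((-x)*y),\qquad (\dot\lambda(x)\phi)(y)=\lim_{t\to0}\frac{\phi((-tx)*y)-\phi(y)}{t},$$ the latter whenever the limit ($t\in\mathbb K\setminus\{0\}$) exists, and let $$\mathcal F_G=\overline{\operatorname{span}}\,\bigl(\lambda(G)\mathfrak g^*\bigr)$$ be the closed linear span in $\mathcal C(\mathfrak g,\mathbb K)$, with the induced topology. Then the following assertions hold. 1. $\mathcal F_G$ is a closed linear subspace of $\mathcal C(\mathfrak g,\mathbb K)$ contained in $\mathcal P_N(\mathfrak g,\mathbb K)$; it is invariant under $\lambda(x)$ for every $x\in G$ and contains the constant functions. 2. The mapping $x\mapsto\lambda_G(x):=\lambda(x)|_{\mathcal F_G}$ is a faithful (injective) representation of the group $G$ by continuous linear operators on $\mathcal F_G$. It is smooth, in the sense that for every $\phi\in\mathcal F_G$ the orbit map $G\to\mathcal F_G$, $x\mapsto\lambda_G(x)\phi$, is smooth (in the sense of Michal–Bastiani: all iterated directional derivatives exist and are continuous). Moreover $(\lambda_G(x)-\mathbf 1)^{2^{N-1}N+1}=0$ for every $x\in G$. 3. For all $x\in\mathfrak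 g$ and $\phi\in\mathcal F_G$ the function $\dot\lambda(x)\phi$ exists and belongs to $\mathcal F_G$, and it equals $\lim_{t\to0}t^{-1}(\lambda_G(tx)\phi-\phi)$ in the topology of $\mathcal F_G$. The mapping $x\mapsto\dot\lambda_G(x):=\dot\lambda(x)|_{\mathcal F_G}$ is a faithful (injective) representation of the Lie algebra $\mathfrak g$ by continuous linear operators on $\mathcal F_G$, and $\dot\lambda_G(x)^{2^{N-1}N+1}=0$ for every $x\in\mathfrak g$. -/

import Mathlib

open Filter Topology
open scoped UniformConvergence

universe u v

/-- Joint continuity of the Lie bracket: the compatibility between bracket and topology in the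
definition of a topological (in particular, locally convex) Lie algebra. -/
class ContinuousLieBracket (𝔤 : Type u) [LieRing 𝔤] [TopologicalSpace 𝔤] : Prop where
  continuous_bracket : Continuous fun p : 𝔤 × 𝔤 => ⁅p.1, p.2⁆

noncomputable section

section BCH

variable (𝕜 : Type v) [RCLike 𝕜] {𝔤 : Type u} [LieRing 𝔤] [LieAlgebra 𝕜 𝔤]

/-- The Baker-Campbell-Hausdorff product, in Dynkin's form
`x ∗ y = x + ∑ (-1)^k / ((k+1) (q₁+⋯+q_k+1))
    (ad x)^{p₁} (ad y)^{q₁} ⋯ (ad x)^{p_k} (ad y)^{q_k} (ad x)^m y / (p₁! q₁! ⋯ p_k! q_k! m!)`,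
the sum being over `k, m ≥ 0` and `(p_i, q_i) ≠ (0, 0)`.
If all brackets of more than `N` elements vanish, then a term can be nonzero only if
`k`, `m`, `p_i`, `q_i` are all `< N`, so this finite sum is the whole series. -/
def bch (N : ℕ) (x y : 𝔤) : 𝔤 :=
  x + ∑ k ∈ Finset.range N,
    ∑ p ∈ Fintype.piFinset
        (fun _ : Fin k => (Finset.range N ×ˢ Finset.range N).erase ((0, 0) : ℕ × ℕ)),
      ∑ m ∈ Finset.range N,
        ((-1 : 𝕜) ^ k /
            ((k + 1) * ((∑ i, ((p i).2 : 𝕜)) + 1) *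
              (∏ i, (((p i).1.factorial : 𝕜) * ((p i).2.factorial : 𝕜))) * (m.factorial : 𝕜))) •
          ((List.ofFn fun i : Fin k =>
              LieAlgebra.ad 𝕜 𝔤 x ^ (p i).1 * LieAlgebra.ad 𝕜 𝔤 y ^ (p i).2).prod *
            LieAlgebra.ad 𝕜 𝔤 x ^ m) y

variable [TopologicalSpace 𝔤]

theorem continuous_ad_pow_apply [ContinuousLieBracket 𝔤] (n : ℕ) {f g : 𝔤 → 𝔤}
    (hf : Continuous f) (hg : Continuous g) :
    Continuous fun y => (LieAlgebra.ad 𝕜 𝔤 (f y) ^ n) (g y) := by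
  induction n with
  | zero => simpa using hg
  | succ n ih =>
    simp only [pow_succ', Module.End.mul_apply, LieAlgebra.ad_apply]
    exact ContinuousLieBracket.continuous_bracket.comp (hf.prodMk ih)

theorem continuous_bch_right [IsTopologicalAddGroup 𝔤] [ContinuousConstSMul 𝕜 𝔤]
    [ContinuousLieBracket 𝔤] (N : ℕ) (x : 𝔤) : Continuous fun y => bch 𝕜 N x y := by
  unfold bch
  refine continuous_const.add (continuous_finsetSum _ fun k _ => continuous_finsetSum _
    fun p _ => continuous_finsetSum _ fun m _ => Continuous.const_smul ?_ _)
  simp only [Module.End.mul_apply]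
  have key : ∀ (l : List (ℕ × ℕ)) {g : 𝔤 → 𝔤}, Continuous g → Continuous fun y =>
      ((l.map fun q => LieAlgebra.ad 𝕜 𝔤 x ^ q.1 * LieAlgebra.ad 𝕜 𝔤 y ^ q.2).prod) (g y) := by
    intro l g hg
    induction l with
    | nil => simpa using hg
    | cons q l ih =>
      simp only [List.map_cons, List.prod_cons, Module.End.mul_apply]
      exact continuous_ad_pow_apply 𝕜 _ continuous_const
        (continuous_ad_pow_apply 𝕜 _ continuous_id ih)
  have := key (List.ofFn p) (continuous_ad_pow_apply 𝕜 m continuous_const continuous_id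
    (f := fun _ => x))
  simpa only [List.map_ofFn, Function.comp_def, id] using this

end BCH

section FunctionSpaces

variable (𝕜 : Type v) [RCLike 𝕜] (𝔤 : Type u) [TopologicalSpace 𝔤]

/-- The space of continuous functions `𝔤 → 𝕜`, with the pointwise vector space structure; a copy
of `C(𝔤, 𝕜)`, which Mathlib equips with the compact-open topology. -/
def ContFun : Type (max u v) := C(𝔤, 𝕜)

namespace ContFun

instance instAddCommGroup : AddCommGroup (ContFun 𝕜 𝔤) := inferInstanceAs (AddCommGroup C(𝔤, 𝕜))

instance instModule : Module 𝕜 (ContFun 𝕜 𝔤) := inferInstanceAs (Module 𝕜 C(𝔤, 𝕜))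

instance instFunLike : FunLike (ContFun 𝕜 𝔤) 𝔤 𝕜 := inferInstanceAs (FunLike C(𝔤, 𝕜) 𝔤 𝕜)

variable {𝕜 𝔤}

/-- A continuous function as an element of `ContFun`. -/
def mk (f : 𝔤 → 𝕜) (hf : Continuous f) : ContFun 𝕜 𝔤 := (⟨f, hf⟩ : C(𝔤, 𝕜))

@[simp] theorem mk_apply (f : 𝔤 → 𝕜) (hf : Continuous f) (y : 𝔤) : mk f hf y = f y := rfl

@[simp] theorem add_apply (φ ψ : ContFun 𝕜 𝔤) (y : 𝔤) : (φ + ψ) y = φ y + ψ y := rfl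

@[simp] theorem smul_apply (c : 𝕜) (φ : ContFun 𝕜 𝔤) (y : 𝔤) : (c • φ) y = c * φ y := rfl

@[simp] theorem zero_apply (y : 𝔤) : (0 : ContFun 𝕜 𝔤) y = 0 := rfl

theorem continuous (φ : ContFun 𝕜 𝔤) : Continuous φ := ContinuousMap.continuous (Y := 𝕜) φ

variable (𝕜 𝔤) [AddCommGroup 𝔤] [Module 𝕜 𝔤]

/-- The inclusion into the space of all functions, the latter with the topology of uniform
convergence on the (von Neumann) bounded subsets of `𝔤`. -/
def toUniformOn : ContFun 𝕜 𝔤 →+ (𝔤 →ᵤ[{B : Set 𝔤 | Bornology.IsVonNBounded 𝕜 B}] 𝕜) where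
  toFun φ := UniformOnFun.ofFun _ φ
  map_zero' := rfl
  map_add' _ _ := rfl

/-- The topology of uniform convergence on the bounded subsets of `𝔤`. -/
instance instTopologicalSpace : TopologicalSpace (ContFun 𝕜 𝔤) :=
  TopologicalSpace.induced (toUniformOn 𝕜 𝔤) inferInstance

instance instIsTopologicalAddGroup : IsTopologicalAddGroup (ContFun 𝕜 𝔤) :=
  topologicalAddGroup_induced (toUniformOn 𝕜 𝔤)

instance instContinuousConstSMul : ContinuousConstSMul 𝕜 (ContFun 𝕜 𝔤) :=
  Topology.IsInducing.continuousConstSMul (g := toUniformOn 𝕜 𝔤) ⟨rfl⟩ id (fun {_ _} => rfl)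

end ContFun

variable [AddCommGroup 𝔤] [Module 𝕜 𝔤]

instance instContinuousConstSMulSubmodule (S : Submodule 𝕜 (ContFun 𝕜 𝔤)) :
    ContinuousConstSMul 𝕜 S :=
  ⟨fun c => (continuous_subtype_val.const_smul c).subtype_mk _⟩

/-- The continuous polynomial functions of degree `≤ m`: the sums of the restrictions to the
diagonal of continuous `j`-linear forms, `j = 0, …, m`. -/
def ContPoly (m : ℕ) : Submodule 𝕜 (ContFun 𝕜 𝔤) where
  carrier := {φ | ∃ A : ∀ j : ℕ, ContinuousMultilinearMap 𝕜 (fun _ : Fin j => 𝔤) 𝕜,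
    ∀ y, φ y = ∑ j ∈ Finset.range (m + 1), A j (fun _ => y)}
  add_mem' := by
    rintro f g ⟨A, hA⟩ ⟨B, hB⟩
    exact ⟨fun j => A j + B j, fun y => by simp [hA, hB, Finset.sum_add_distrib]⟩
  zero_mem' := ⟨fun _ => 0, fun y => by simp⟩
  smul_mem' := by
    rintro c f ⟨A, hA⟩
    exact ⟨fun j => c • A j, fun y => by simp [hA, Finset.mul_sum]⟩

end FunctionSpaces

section RegularRepresentation

variable (𝕜 : Type v) [RCLike 𝕜] {𝔤 : Type u} [LieRing 𝔤] [LieAlgebra 𝕜 𝔤]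
  [TopologicalSpace 𝔤] [IsTopologicalAddGroup 𝔤] [ContinuousConstSMul 𝕜 𝔤]
  [ContinuousLieBracket 𝔤]

/-- The left regular representation, `(λ(x)φ)(y) = φ((-x) ∗ y)`. -/
def leftReg (N : ℕ) (x : 𝔤) : ContFun 𝕜 𝔤 →ₗ[𝕜] ContFun 𝕜 𝔤 where
  toFun φ := ContFun.mk (fun y => φ (bch 𝕜 N (-x) y))
    (φ.continuous.comp (continuous_bch_right 𝕜 N (-x)))
  map_add' _ _ := rfl
  map_smul' _ _ := rfl

variable (𝔤)

/-- `F_G`, the closed linear span of `λ(G)𝔤*` in the space of continuous functions. -/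
def FG (N : ℕ) : Submodule 𝕜 (ContFun 𝕜 𝔤) :=
  (Submodule.span 𝕜 {φ | ∃ (x : 𝔤) (ξ : 𝔤 →L[𝕜] 𝕜),
    φ = leftReg 𝕜 N x (ContFun.mk ξ ξ.continuous)}).topologicalClosure

variable {𝔤}

/-- `λ̇(x)φ` exists and equals `ψ`, that is,
`ψ(y) = lim_{t → 0} (φ((-tx) ∗ y) - φ(y)) / t` for all `y`. -/
def IsLambdaDot (N : ℕ) (x : 𝔤) (φ ψ : ContFun 𝕜 𝔤) : Prop :=
  ∀ y : 𝔤, Tendsto (fun t : 𝕜 => (φ (bch 𝕜 N (-(t • x)) y) - φ y) / t)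
    (𝓝[≠] 0) (𝓝 (ψ y))

end RegularRepresentation

section Smooth

/-- `C^k`-maps between topological vector spaces in the sense of Michal and Bastiani:
`f` is `C^0` if it is continuous, and `C^{k+1}` if it is continuous, all its directional
derivatives `df(x, v)` exist and `df : E × E → F` is `C^k`. -/
def IsCk (𝕜 : Type*) [RCLike 𝕜] {F : Type*} [AddCommGroup F] [Module 𝕜 F] [TopologicalSpace F] :
    ℕ → ∀ (E : Type u) [AddCommGroup E] [Module 𝕜 E] [TopologicalSpace E], (E → F) → Prop
  | 0, _, _, _, _, f => Continuous f
  | k + 1, E, _, _, _, f => Continuous f ∧ ∃ df : E × E → F,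
      (∀ x v : E, Tendsto (fun t : 𝕜 => t⁻¹ • (f (x + t • v) - f x)) (𝓝[≠] 0) (𝓝 (df (x, v)))) ∧
        IsCk 𝕜 k (E × E) df

/-- Smooth maps between topological vector spaces (Michal-Bastiani calculus). -/
def IsSmoothMap (𝕜 : Type*) [RCLike 𝕜] {F : Type*} [AddCommGroup F] [Module 𝕜 F]
    [TopologicalSpace F] {E : Type u} [AddCommGroup E] [Module 𝕜 E] [TopologicalSpace E]
    (f : E → F) : Prop :=
  ∀ k : ℕ, IsCk 𝕜 k E f

end Smooth

end

/-!
Associativity of `∗`: for nilpotent `a`, `b` in an associative algebra, `log (e^a e^{tb})` and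
Dynkin's series satisfy the same differential equation in `t`, so `e^{a ∗ b} = e^a e^b`. The Lie
algebra `𝕜[X] ⊗ 𝔤` acts by nilpotent operators on its semidirect product with the derivation
`d/dX`, and `e^a` determines the action of `a`, hence `da/dX`. Thus `(Xx ∗ Xy) ∗ Xz` and
`Xx ∗ (Xy ∗ Xz)` have the same derivative, and they agree at `X = 0`; evaluate at `X = 1`.

Along polynomial curves of degree `d` the functions `ξ((-x) ∗ y)`, `ξ ∈ 𝔤*`, are polynomials of
degree at most `N d`. By Lagrange interpolation this amounts to linear equations between values at
finitely many points, so it survives the passage to the closure `F_G`. Hence elements of `F_G` are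
continuous polynomials, and `t ↦ φ((-tx) ∗ y)` has degree at most `N² ≤ 2^(N-1) N`, which bounds
the nilpotency of both `λ(x) - 1` (a difference operator) and `λ̇(x)` (a derivative). Moreover
`λ̇(x)` is a fixed linear combination of `λ(0), λ(x), …, λ(N² x)`, which makes it a continuous
operator on `F_G`; the same interpolation formula, applied to `x ↦ λ(x)φ`, shows that this map is
smooth. The constants lie in `F_G` because `ξ - λ(z)ξ = ξ(z)` for central `z`.
-/

/-! ### Truncated exponential and logarithm -/

section TruncatedSeries

open Polynomial

/-- The truncation `∑_{i < M} X^i / (i+1)!` of the power series `(e^X - 1) / X`. -/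
noncomputable def expDiv (M : ℕ) : ℚ[X] :=
  ∑ i ∈ Finset.range M, C (((i + 1).factorial : ℚ)⁻¹) * X ^ i

/-- The truncation `∑_{k < M} (-1)^k X^k / (k+1)` of the power series `log (1 + X) / X`. -/
noncomputable def logDiv (M : ℕ) : ℚ[X] :=
  ∑ k ∈ Finset.range M, C ((-1 : ℚ) ^ k / (k + 1)) * X ^ k

theorem one_add_X_mul_derivative_X_mul_logDiv (M : ℕ) :
    (1 + X) * derivative (X * logDiv M) = 1 - (-X : ℚ[X]) ^ M := by
  have h : derivative (X * logDiv M) = ∑ k ∈ Finset.range M, (-X : ℚ[X]) ^ k := by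
    rw [logDiv, Finset.mul_sum, derivative_sum]
    refine Finset.sum_congr rfl fun k _ => ?_
    have hk : (k + 1 : ℚ) ≠ 0 := by positivity
    rw [show (X : ℚ[X]) * (C ((-1 : ℚ) ^ k / (k + 1)) * X ^ k)
      = C ((-1 : ℚ) ^ k / (k + 1)) * X ^ (k + 1) by ring, derivative_C_mul_X_pow]
    push_cast
    rw [div_mul_cancel₀ _ hk, neg_pow (X : ℚ[X])]
    simp
  rw [h, show (1 + X : ℚ[X]) = 1 - (-X) by ring, mul_neg_geom_sum]

theorem derivative_X_mul_expDiv (M : ℕ) :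
    derivative (X * expDiv M) = 1 + X * expDiv M - C ((M.factorial : ℚ)⁻¹) * X ^ M := by
  induction M with
  | zero => simp [expDiv]
  | succ M ih =>
    have h : X * expDiv (M + 1)
        = X * expDiv M + C (((M + 1).factorial : ℚ)⁻¹) * X ^ (M + 1) := by
      simp only [expDiv, Finset.sum_range_succ]; ring
    have hM : (((M + 1).factorial : ℚ)⁻¹) * ((M + 1 : ℕ) : ℚ) = (M.factorial : ℚ)⁻¹ := by
      rw [Nat.factorial_succ]
      push_cast
      field_simp
    rw [h, derivative_add, ih, derivative_C_mul_X_pow, hM, Nat.add_sub_cancel]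
    ring

theorem X_pow_dvd_of_derivative_X_mul {g : ℚ[X]} {M : ℕ} (h : X ^ M ∣ derivative (X * g)) :
    X ^ M ∣ g := by
  rw [X_pow_dvd_iff] at h ⊢
  intro d hd
  have := h d hd
  rw [coeff_derivative, coeff_X_mul] at this
  exact (mul_eq_zero.mp this).resolve_right (by positivity)

theorem X_pow_dvd_of_one_add_X_mul_derivative_sub {g : ℚ[X]} {M : ℕ} (h0 : g.coeff 0 = 0)
    (h : X ^ M ∣ (1 + X) * derivative g - g) : X ^ M ∣ g := by
  rw [X_pow_dvd_iff] at h ⊢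
  intro n
  induction n with
  | zero => exact fun _ => h0
  | succ n ih =>
    intro hn
    have hg := ih (Nat.lt_of_succ_lt hn)
    have := h n (Nat.lt_of_succ_lt hn)
    have hX : (X * derivative g).coeff n = g.coeff n * n := by
      cases n <;> simp [coeff_derivative]
    rw [coeff_sub, add_mul, one_mul, coeff_add, hX, hg, coeff_derivative, zero_mul, add_zero,
      sub_zero] at this
    exact (mul_eq_zero.mp this).resolve_right (by positivity)

theorem X_pow_dvd_logDiv_comp_mul_expDiv_sub_one (M : ℕ) :
    (X : ℚ[X]) ^ M ∣ (logDiv (M + 1)).comp (X * expDiv M) * expDiv M - 1 := by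
  set P : ℚ[X] := X * expDiv M with hP
  set L : ℚ[X] := X * logDiv (M + 1) with hL
  have hcomp : X * ((logDiv (M + 1)).comp P * expDiv M) = L.comp P := by
    rw [hL, mul_comp, X_comp, hP]
    ring
  have hlog := congrArg (·.comp P) (one_add_X_mul_derivative_X_mul_logDiv (M + 1))
  simp only [mul_comp, add_comp, one_comp, X_comp, sub_comp, pow_comp, neg_comp] at hlog
  refine X_pow_dvd_of_derivative_X_mul ⟨-((-1) ^ (M + 1) * X * expDiv M ^ (M + 1))
    - C ((M.factorial : ℚ)⁻¹) * (derivative L).comp P, ?_⟩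
  rw [mul_sub, hcomp, derivative_sub, derivative_comp, mul_one, derivative_X, hP,
    derivative_X_mul_expDiv, ← hP, sub_mul, hlog, neg_pow P, hP, mul_pow]
  ring

theorem X_pow_dvd_expDiv_comp_sub_X (M : ℕ) :
    (X : ℚ[X]) ^ M ∣ (X * expDiv M).comp (X * logDiv M) - X := by
  set P : ℚ[X] := X * expDiv M with hP
  set L : ℚ[X] := X * logDiv M with hL
  refine X_pow_dvd_of_one_add_X_mul_derivative_sub ?_
    ⟨(C (-(M.factorial : ℚ)⁻¹) * logDiv M ^ M) * (1 - (-X) ^ M) - (1 + P.comp L) * (-1) ^ M, ?_⟩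
  · simp [coeff_zero_eq_eval_zero, hP, hL]
  have hexp := congrArg (·.comp L) (derivative_X_mul_expDiv M)
  simp only [mul_comp, add_comp, one_comp, sub_comp, pow_comp, X_comp, C_comp, ← hP] at hexp
  have hlog : (1 + X) * derivative L = 1 - (-X) ^ M := one_add_X_mul_derivative_X_mul_logDiv M
  calc (1 + X) * derivative (P.comp L - X) - (P.comp L - X)
      = (1 + X) * derivative L * (derivative P).comp L - (1 + P.comp L) := by
        rw [derivative_sub, derivative_comp, derivative_X]; ring
    _ = _ := by
        rw [hlog, hexp, neg_pow (X : ℚ[X]), C_neg]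
        nth_rewrite 2 [hL]
        ring

variable {R : Type*} [Ring R] [Algebra ℚ R]

theorem exp_eq_one_add_mul_aeval_expDiv {w : R} {M : ℕ} (hw : w ^ M = 0) :
    IsNilpotent.exp w = 1 + w * aeval w (expDiv M) := by
  rw [IsNilpotent.exp_eq_sum (k := M + 1) (by rw [pow_succ, hw, zero_mul]),
    Finset.sum_range_succ', add_comm]
  simp [expDiv, Finset.mul_sum, ← Algebra.smul_def, pow_succ']

theorem aeval_logDiv_mul_aeval_expDiv {w : R} {M : ℕ} (hw : w ^ M = 0) :
    aeval (IsNilpotent.exp w - 1) (logDiv (M + 1)) * aeval w (expDiv M) = 1 := by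
  obtain ⟨Q, hQ⟩ := X_pow_dvd_logDiv_comp_mul_expDiv_sub_one M
  have := congrArg (aeval w) hQ
  rw [map_sub, map_mul, aeval_comp, map_mul, aeval_X, map_mul, map_pow, aeval_X, hw, zero_mul,
    map_one, sub_eq_zero] at this
  rwa [exp_eq_one_add_mul_aeval_expDiv hw, add_sub_cancel_left]

/-- The truncated logarithm `∑_{k < M} (-1)^k u^(k+1) / (k+1)` of `1 + u`, which is the whole
logarithm as soon as `u ^ M = 0`. -/
noncomputable def nilLog (M : ℕ) (u : R) : R := aeval u (X * logDiv M)

theorem nilLog_exp {w : R} {M : ℕ} (hw : w ^ M = 0) :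
    nilLog (M + 1) (IsNilpotent.exp w - 1) = w := by
  have hexp : IsNilpotent.exp w - 1 = aeval w (X * expDiv M) := by
    rw [exp_eq_one_add_mul_aeval_expDiv hw]
    simp
  have hc : Commute (aeval w (expDiv M)) (aeval (IsNilpotent.exp w - 1) (logDiv (M + 1))) := by
    rw [hexp, ← aeval_comp]
    exact (Commute.all _ _).map (aeval w)
  calc nilLog (M + 1) (IsNilpotent.exp w - 1)
      = (IsNilpotent.exp w - 1) * aeval (IsNilpotent.exp w - 1) (logDiv (M + 1)) := by
        rw [nilLog, map_mul, aeval_X]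
    _ = w * (aeval w (expDiv M) * aeval (IsNilpotent.exp w - 1) (logDiv (M + 1))) := by
        nth_rewrite 1 [hexp]
        rw [map_mul, aeval_X, mul_assoc]
    _ = w := by rw [hc.eq, aeval_logDiv_mul_aeval_expDiv hw, mul_one]

theorem exp_injective_of_isNilpotent {w w' : R} (hw : IsNilpotent w) (hw' : IsNilpotent w')
    (h : IsNilpotent.exp w = IsNilpotent.exp w') : w = w' := by
  obtain ⟨m, hm⟩ := hw
  obtain ⟨n, hn⟩ := hw'
  rw [← nilLog_exp (pow_eq_zero_of_le (le_max_left m n) hm), h,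
    nilLog_exp (pow_eq_zero_of_le (le_max_right m n) hn)]

theorem nilLog_pow_eq_zero {u : R} {n : ℕ} (hu : u ^ n = 0) (M : ℕ) : nilLog M u ^ n = 0 := by
  rw [nilLog, ← map_pow, mul_pow, map_mul, map_pow, aeval_X, hu, zero_mul]

theorem exp_nilLog {u : R} {M : ℕ} (hu : u ^ M = 0) :
    IsNilpotent.exp (nilLog M u) = 1 + u := by
  obtain ⟨Q, hQ⟩ := X_pow_dvd_expDiv_comp_sub_X M
  have := congrArg (aeval u) hQ
  rw [map_sub, aeval_comp, ← nilLog, map_mul, aeval_X, aeval_X, map_mul, map_pow, aeval_X, hu,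
    zero_mul, sub_eq_zero] at this
  rw [exp_eq_one_add_mul_aeval_expDiv (nilLog_pow_eq_zero hu M), this]

theorem map_nilLog {R' : Type*} [Ring R'] [Algebra ℚ R'] (f : R →ₐ[ℚ] R') (M : ℕ) (u : R) :
    f (nilLog M u) = nilLog M (f u) :=
  (aeval_algHom_apply f u _).symm

end TruncatedSeries

/-! ### The adjoint action in an associative algebra -/

section ExpAd

open Polynomial

attribute [local instance] LieRing.ofAssociativeRing

theorem aeval_apply_of_apply_eq_zero {K 𝕜 V : Type*} [CommRing K] [CommRing 𝕜] [Algebra K 𝕜]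
    [AddCommGroup V] [Module K V] [Module 𝕜 V] [IsScalarTower K 𝕜 V] {D : Module.End 𝕜 V}
    {v : V} (h : D v = 0) (q : K[X]) : aeval D q v = q.coeff 0 • v := by
  rw [← divX_mul_X_add q]
  simp [h]

section CommRing

variable {𝕜 S : Type*} [CommRing 𝕜] [Ring S] [Algebra 𝕜 S]

theorem ad_eq_mulLeft_add_mulRight_neg (Z : S) :
    LieAlgebra.ad 𝕜 S Z = LinearMap.mulLeft 𝕜 Z + LinearMap.mulRight 𝕜 (-Z) := by
  ext y
  simp [LieRing.of_associative_ring_bracket, sub_eq_add_neg]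

theorem ad_pow_eq_zero {Z : S} {n : ℕ} (hZ : Z ^ n = 0) :
    LieAlgebra.ad 𝕜 S Z ^ (2 * n) = 0 := by
  rw [ad_eq_mulLeft_add_mulRight_neg]
  refine (LinearMap.commute_mulLeft_right Z (-Z)).add_pow_eq_zero_of_add_le_succ_of_pow_eq_zero
    (m := n) (n := n) ?_ ?_ (by lia)
  · rw [LinearMap.pow_mulLeft, hZ, LinearMap.mulLeft_zero_eq_zero]
  · rw [LinearMap.pow_mulRight, neg_pow, hZ, mul_zero, LinearMap.mulRight_zero_eq_zero]

theorem derivation_pow (δ : S →+ S) (hδ : ∀ a b, δ (a * b) = δ a * b + a * δ b) (Z : S) (n : ℕ) :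
    δ (Z ^ n) = ∑ k ∈ Finset.range n,
      n.choose (k + 1) • ((LieAlgebra.ad 𝕜 S Z ^ k) (δ Z) * Z ^ (n - 1 - k)) := by
  induction n with
  | zero => simpa using hδ 1 1
  | succ n ih =>
    have hstep (A : S) : Z * A = LieAlgebra.ad 𝕜 S Z A + A * Z := by
      simp [LieAlgebra.ad_apply, LieRing.of_associative_ring_bracket]
    have hterm : ∀ k ∈ Finset.range n, Z * (n.choose (k + 1) •
        ((LieAlgebra.ad 𝕜 S Z ^ k) (δ Z) * Z ^ (n - 1 - k)))
        = n.choose (k + 1) • ((LieAlgebra.ad 𝕜 S Z ^ (k + 1)) (δ Z) * Z ^ (n - (k + 1)))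
          + n.choose (k + 1) • ((LieAlgebra.ad 𝕜 S Z ^ k) (δ Z) * Z ^ (n - k)) := by
      intro k hk
      have hk := Finset.mem_range.mp hk
      rw [mul_smul_comm, ← mul_assoc, hstep, add_mul, ← smul_add, ← Module.End.mul_apply,
        ← pow_succ', mul_assoc, ← pow_succ', show n - 1 - k + 1 = n - k by lia,
        show n - 1 - k = n - (k + 1) by lia]
    rw [pow_succ', hδ, ih, Finset.mul_sum, Finset.sum_congr rfl hterm, Finset.sum_add_distrib,
      Nat.add_sub_cancel]
    simp only [Nat.choose_succ_succ' n, add_smul, Finset.sum_add_distrib]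
    rw [Finset.sum_range_succ' _ n, Finset.sum_range_succ (fun k => n.choose (k + 1) • _) n]
    simp
    abel

end CommRing

theorem sum_range_sum_antidiagonal {G : Type*} [AddCommMonoid G] (M : ℕ) (f : ℕ → ℕ → G)
    (h₁ : ∀ i j, M ≤ i → f i j = 0) (h₂ : ∀ i j, M ≤ j → f i j = 0) :
    ∑ n ∈ Finset.range (2 * M), ∑ p ∈ Finset.HasAntidiagonal.antidiagonal n, f p.1 p.2
      = ∑ i ∈ Finset.range M, ∑ j ∈ Finset.range M, f i j := by
  rw [← Finset.sum_product', ← Finset.sum_fiberwise_of_maps_to (t := Finset.range (2 * M))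
    (g := fun p : ℕ × ℕ => p.1 + p.2)]
  · refine Finset.sum_congr rfl fun n _ => (Finset.sum_subset ?_ ?_).symm
    · intro p hp
      simpa using (Finset.mem_filter.mp hp).2
    · intro p hp hp'
      simp only [Finset.mem_filter, Finset.HasAntidiagonal.mem_antidiagonal, Finset.mem_product,
        Finset.mem_range] at hp hp'
      by_cases h : M ≤ p.1
      · exact h₁ _ _ h
      · exact h₂ _ _ (by by_contra h'; exact hp' ⟨⟨by lia, by lia⟩, hp⟩)
  · intro p hp
    simp only [Finset.mem_product, Finset.mem_range] at hp ⊢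
    lia

section RatAlgebra

variable {𝕜 S : Type*} [CommRing 𝕜] [Ring S] [Algebra 𝕜 S] [Algebra ℚ S]

theorem exp_ad_apply {Z : S} (hZ : IsNilpotent Z) (y : S) :
    IsNilpotent.exp (LieAlgebra.ad 𝕜 S Z) y = IsNilpotent.exp Z * y * IsNilpotent.exp (-Z) := by
  obtain ⟨n, hn⟩ := hZ
  have hn' : (-Z) ^ n = 0 := by rw [neg_pow, hn, mul_zero]
  have hL : LinearMap.mulLeft 𝕜 Z ^ n = 0 := by
    rw [LinearMap.pow_mulLeft, hn, LinearMap.mulLeft_zero_eq_zero]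
  have hR : LinearMap.mulRight 𝕜 (-Z) ^ n = 0 := by
    rw [LinearMap.pow_mulRight, hn', LinearMap.mulRight_zero_eq_zero]
  rw [ad_eq_mulLeft_add_mulRight_neg, IsNilpotent.exp_add_of_commute
    (LinearMap.commute_mulLeft_right Z (-Z)) ⟨n, hL⟩ ⟨n, hR⟩, Module.End.mul_apply,
    IsNilpotent.exp_eq_sum hL, IsNilpotent.exp_eq_sum hR, IsNilpotent.exp_eq_sum hn,
    IsNilpotent.exp_eq_sum hn', mul_assoc, Finset.mul_sum, Finset.sum_mul]
  simp only [LinearMap.pow_mulLeft, LinearMap.pow_mulRight, LinearMap.sum_apply,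
    LinearMap.smul_apply, LinearMap.mulLeft_apply, LinearMap.mulRight_apply, Finset.mul_sum,
    smul_mul_assoc, mul_smul_comm, Finset.smul_sum, smul_comm (_⁻¹ : ℚ) (_⁻¹ : ℚ)]

theorem exp_ad_eq_mul {x y z : S} (hx : IsNilpotent x) (hy : IsNilpotent y) (hz : IsNilpotent z)
    (h : IsNilpotent.exp z = IsNilpotent.exp x * IsNilpotent.exp y) :
    IsNilpotent.exp (LieAlgebra.ad 𝕜 S z)
      = IsNilpotent.exp (LieAlgebra.ad 𝕜 S x) * IsNilpotent.exp (LieAlgebra.ad 𝕜 S y) := by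
  have hneg : IsNilpotent.exp (-z) = IsNilpotent.exp (-y) * IsNilpotent.exp (-x) := by
    refine left_inv_eq_right_inv (IsNilpotent.exp_neg_mul_exp_self hz) ?_
    rw [h, mul_assoc, ← mul_assoc (IsNilpotent.exp y), IsNilpotent.exp_mul_exp_neg_self hy,
      one_mul, IsNilpotent.exp_mul_exp_neg_self hx]
  ext1 c
  rw [Module.End.mul_apply, exp_ad_apply hy, exp_ad_apply hx, exp_ad_apply hz, h, hneg]
  simp only [mul_assoc]

variable [Algebra ℚ 𝕜]

theorem exp_ad_apply_of_commute {Z c : S} (hZ : IsNilpotent Z) (h : Commute Z c) :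
    IsNilpotent.exp (LieAlgebra.ad 𝕜 S Z) c = c := by
  obtain ⟨n, hn⟩ := hZ
  have hZc : LieAlgebra.ad 𝕜 S Z c = 0 := by
    rw [LieAlgebra.ad_apply, LieRing.of_associative_ring_bracket, h.eq, sub_self]
  rw [exp_eq_one_add_mul_aeval_expDiv (ad_pow_eq_zero (𝕜 := 𝕜) hn), LinearMap.add_apply,
    Module.End.mul_apply, aeval_apply_of_apply_eq_zero hZc, map_rat_smul, hZc, smul_zero, add_zero,
    Module.End.one_apply]

theorem derivation_exp (δ : S →+ S) (hδ : ∀ a b, δ (a * b) = δ a * b + a * δ b) {Z : S} {M : ℕ}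
    (hZ : Z ^ M = 0) (hA : LieAlgebra.ad 𝕜 S Z ^ M = 0) :
    δ (IsNilpotent.exp Z)
      = aeval (LieAlgebra.ad 𝕜 S Z) (expDiv M) (δ Z) * IsNilpotent.exp Z := by
  set f : ℕ → ℕ → S := fun k j => ((k + 1).factorial : ℚ)⁻¹ • (j.factorial : ℚ)⁻¹ •
    ((LieAlgebra.ad 𝕜 S Z ^ k) (δ Z) * Z ^ j) with hf
  have hpow (n : ℕ) : δ (((n + 1).factorial : ℚ)⁻¹ • Z ^ (n + 1))
      = ∑ p ∈ Finset.HasAntidiagonal.antidiagonal n, f p.1 p.2 := by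
    rw [map_rat_smul, derivation_pow (𝕜 := 𝕜) δ hδ, Finset.smul_sum,
      Finset.Nat.sum_antidiagonal_eq_sum_range_succ f]
    refine Finset.sum_congr rfl fun k hk => ?_
    have hk : k ≤ n := Nat.lt_succ_iff.mp (Finset.mem_range.mp hk)
    simp only [hf, Nat.add_sub_cancel, ← Nat.cast_smul_eq_nsmul ℚ, smul_smul]
    rw [Nat.cast_choose ℚ (Nat.succ_le_succ hk), Nat.succ_sub_succ]
    congr 1
    field_simp
  calc δ (IsNilpotent.exp Z)
      = ∑ n ∈ Finset.range (2 * M), ∑ p ∈ Finset.HasAntidiagonal.antidiagonal n, f p.1 p.2 := by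
        rw [IsNilpotent.exp_eq_sum (pow_eq_zero_of_le (show M ≤ 2 * M + 1 by lia) hZ), map_sum,
          Finset.sum_range_succ', Finset.sum_congr rfl fun n _ => hpow n, map_rat_smul,
          derivation_pow (𝕜 := 𝕜) δ hδ]
        simp
    _ = ∑ i ∈ Finset.range M, ∑ j ∈ Finset.range M, f i j :=
        sum_range_sum_antidiagonal M f (fun i j h => by simp [hf, pow_eq_zero_of_le h hA])
          (fun i j h => by simp [hf, pow_eq_zero_of_le h hZ])
    _ = aeval (LieAlgebra.ad 𝕜 S Z) (expDiv M) (δ Z) * IsNilpotent.exp Z := by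
        rw [IsNilpotent.exp_eq_sum hZ, expDiv]
        simp [hf, Finset.sum_mul_sum, ← Algebra.smul_def, LinearMap.sum_apply,
          smul_comm ((_ + 1).factorial : ℚ)⁻¹]

theorem derivation_exp_of_commute (δ : S →+ S) (hδ : ∀ a b, δ (a * b) = δ a * b + a * δ b) {Z : S}
    (hZ : IsNilpotent Z) (hc : Commute Z (δ Z)) :
    δ (IsNilpotent.exp Z) = δ Z * IsNilpotent.exp Z := by
  obtain ⟨n, hn⟩ := hZ
  have hZδ : LieAlgebra.ad ℚ S Z (δ Z) = 0 := by
    rw [LieAlgebra.ad_apply, LieRing.of_associative_ring_bracket, hc.eq, sub_self]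
  rw [derivation_exp (𝕜 := ℚ) δ hδ (M := 2 * n + 1) (pow_eq_zero_of_le (by lia) hn)
    (pow_eq_zero_of_le (by lia) (ad_pow_eq_zero hn)), aeval_apply_of_apply_eq_zero hZδ]
  simp [expDiv, Finset.sum_range_succ']

end RatAlgebra

end ExpAd

/-! ### The Baker-Campbell-Hausdorff theorem in an associative algebra -/

section Dynkin

/-- The monomial `(ad x)^{p₁} (ad y)^{q₁} ⋯ (ad x)^{p_k} (ad y)^{q_k}`. -/
def adWord (𝕜 : Type*) [CommRing 𝕜] {𝔤 : Type*} [LieRing 𝔤] [LieAlgebra 𝕜 𝔤] (x y : 𝔤)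
    (l : List (ℕ × ℕ)) : Module.End 𝕜 𝔤 :=
  (l.map fun q => LieAlgebra.ad 𝕜 𝔤 x ^ q.1 * LieAlgebra.ad 𝕜 𝔤 y ^ q.2).prod

theorem adWord_ofFn (𝕜 : Type*) [CommRing 𝕜] {𝔤 : Type*} [LieRing 𝔤] [LieAlgebra 𝕜 𝔤] (x y : 𝔤)
    {k : ℕ} (p : Fin k → ℕ × ℕ) :
    adWord 𝕜 x y (List.ofFn p) = (List.ofFn fun i : Fin k =>
      LieAlgebra.ad 𝕜 𝔤 x ^ (p i).1 * LieAlgebra.ad 𝕜 𝔤 y ^ (p i).2).prod := by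
  rw [adWord, List.map_ofFn, Function.comp_def]

/-- The coefficient of
`(ad x)^{p₁} (ad y)^{q₁} ⋯ (ad x)^{p_k} (ad y)^{q_k} (ad x)^m y` in Dynkin's series. -/
def bchCoeff (𝕜 : Type*) [Field 𝕜] {k : ℕ} (p : Fin k → ℕ × ℕ) (m : ℕ) : 𝕜 :=
  (-1 : 𝕜) ^ k / ((k + 1) * ((∑ i, ((p i).2 : 𝕜)) + 1) *
    (∏ i, (((p i).1.factorial : 𝕜) * ((p i).2.factorial : 𝕜))) * (m.factorial : 𝕜))

/-- The pairs of exponents `(p_i, q_i)` over which the truncated Dynkin series is summed. -/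
def bchExponents (N : ℕ) : Finset (ℕ × ℕ) :=
  (Finset.range N ×ˢ Finset.range N).erase ((0, 0) : ℕ × ℕ)

section Functoriality

variable {𝕜 : Type*} [RCLike 𝕜] {𝔤 𝔥 : Type*} [LieRing 𝔤] [LieAlgebra 𝕜 𝔤] [LieRing 𝔥]
  [LieAlgebra 𝕜 𝔥]

theorem bch_eq_sum (N : ℕ) (x y : 𝔤) : bch 𝕜 N x y = x + ∑ k ∈ Finset.range N,
    ∑ p ∈ Fintype.piFinset (fun _ : Fin k => bchExponents N), ∑ m ∈ Finset.range N,
      bchCoeff 𝕜 p m • adWord 𝕜 x y (List.ofFn p) ((LieAlgebra.ad 𝕜 𝔤 x ^ m) y) := by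
  simp only [adWord_ofFn]
  rfl

theorem map_ad_pow_apply (f : 𝔤 →ₗ⁅𝕜⁆ 𝔥) (x y : 𝔤) (n : ℕ) :
    f ((LieAlgebra.ad 𝕜 𝔤 x ^ n) y) = (LieAlgebra.ad 𝕜 𝔥 (f x) ^ n) (f y) := by
  induction n with
  | zero => rfl
  | succ n ih =>
    rw [pow_succ', pow_succ', Module.End.mul_apply, Module.End.mul_apply, ← ih,
      LieAlgebra.ad_apply, LieAlgebra.ad_apply, LieHom.map_lie]

theorem map_adWord_apply (f : 𝔤 →ₗ⁅𝕜⁆ 𝔥) (x y z : 𝔤) (l : List (ℕ × ℕ)) :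
    f (adWord 𝕜 x y l z) = adWord 𝕜 (f x) (f y) l (f z) := by
  induction l with
  | nil => rfl
  | cons q l ih =>
    simp only [adWord, List.map_cons, List.prod_cons, Module.End.mul_apply] at ih ⊢
    rw [map_ad_pow_apply, map_ad_pow_apply, ih]

theorem map_bch (f : 𝔤 →ₗ⁅𝕜⁆ 𝔥) (N : ℕ) (x y : 𝔤) :
    f (bch 𝕜 N x y) = bch 𝕜 N (f x) (f y) := by
  simp only [bch_eq_sum, map_add, map_sum, map_smul, map_adWord_apply, map_ad_pow_apply]

end Functoriality

open Polynomial

theorem sum_pow_eq_sum_piFinset {ι A : Type*} [Semiring A] (s : Finset ι)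
    (f : ι → A) (k : ℕ) :
    (∑ i ∈ s, f i) ^ k
      = ∑ p ∈ Fintype.piFinset (fun _ : Fin k => s), (List.ofFn fun i => f (p i)).prod := by
  induction k with
  | zero => simp
  | succ k ih =>
    rw [pow_succ', ih, Finset.sum_mul_sum, ← Finset.sum_product']
    refine Finset.sum_nbij' (fun q => (Fin.cons q.1 q.2 : Fin (k + 1) → ι))
      (fun p => (p 0, Fin.tail p)) ?_ ?_ ?_ ?_ ?_
    · rintro ⟨i, q⟩ h
      simp only [Finset.mem_product, Fintype.mem_piFinset] at h ⊢
      exact fun j => Fin.cases h.1 h.2 j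
    · intro p h
      simp only [Finset.mem_product, Fintype.mem_piFinset] at h ⊢
      exact ⟨h 0, fun j => h j.succ⟩
    · simp
    · simp
    · simp [List.ofFn_succ]

theorem prod_ofFn_smul {𝕜 A : Type*} [CommSemiring 𝕜] [Semiring A] [Algebra 𝕜 A] {k : ℕ}
    (c : Fin k → 𝕜) (g : Fin k → A) :
    (List.ofFn fun i => c i • g i).prod = (∏ i, c i) • (List.ofFn g).prod := by
  induction k with
  | zero => simp
  | succ k ih => simp [List.ofFn_succ, ih, Fin.prod_univ_succ, smul_smul, mul_comm]

section DynkinExpansion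

variable {𝕜 A : Type*} [Field 𝕜] [CharZero 𝕜] [Ring A] [Algebra 𝕜 A] [Algebra ℚ A]

theorem exp_eq_sum_smul {a : A} {M : ℕ} (ha : a ^ M = 0) :
    IsNilpotent.exp a = ∑ m ∈ Finset.range M, (m.factorial : 𝕜)⁻¹ • a ^ m := by
  rw [IsNilpotent.exp_eq_sum ha]
  refine Finset.sum_congr rfl fun m _ => ?_
  rw [← Rat.cast_smul_eq_qsmul 𝕜, Rat.cast_inv, Rat.cast_natCast]

theorem exp_mul_exp_sub_one_eq_sum {α β : A} {M : ℕ} (hM : 1 ≤ M) (hα : α ^ M = 0)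
    (hβ : β ^ M = 0) :
    IsNilpotent.exp α * IsNilpotent.exp β - 1 = ∑ p ∈ bchExponents M,
      ((p.1.factorial : 𝕜) * (p.2.factorial : 𝕜))⁻¹ • (α ^ p.1 * β ^ p.2) := by
  have h00 : ((0, 0) : ℕ × ℕ) ∈ Finset.range M ×ˢ Finset.range M := by simp; lia
  rw [bchExponents, Finset.sum_erase_eq_sub h00, exp_eq_sum_smul (𝕜 := 𝕜) hα,
    exp_eq_sum_smul (𝕜 := 𝕜) hβ, Finset.sum_mul_sum, ← Finset.sum_product']
  simp [smul_smul, mul_comm]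

theorem aeval_logDiv_exp_mul_exp_sub_one {α β : A} {M : ℕ} (hM : 1 ≤ M) (hα : α ^ M = 0)
    (hβ : β ^ M = 0) :
    aeval (IsNilpotent.exp α * IsNilpotent.exp β - 1) (logDiv M)
      = ∑ k ∈ Finset.range M, ∑ p ∈ Fintype.piFinset (fun _ : Fin k => bchExponents M),
        ((-1 : 𝕜) ^ k / ((k + 1) *
          ∏ i, (((p i).1.factorial : 𝕜) * ((p i).2.factorial : 𝕜)))) •
          (List.ofFn fun i => α ^ (p i).1 * β ^ (p i).2).prod := by
  rw [exp_mul_exp_sub_one_eq_sum (𝕜 := 𝕜) hM hα hβ, logDiv, map_sum]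
  refine Finset.sum_congr rfl fun k _ => ?_
  rw [map_mul, aeval_C, ← Algebra.smul_def, map_pow, aeval_X, sum_pow_eq_sum_piFinset,
    ← Rat.cast_smul_eq_qsmul 𝕜, Finset.smul_sum]
  refine Finset.sum_congr rfl fun p _ => ?_
  rw [prod_ofFn_smul, smul_smul, Finset.prod_inv_distrib, div_mul_eq_div_div,
    div_eq_mul_inv _ (∏ _, _)]
  push_cast
  rfl

end DynkinExpansion

attribute [local instance] LieRing.ofAssociativeRing

section Derivation

variable {𝕜 S : Type*} [Field 𝕜] [CharZero 𝕜] [Ring S] [Algebra 𝕜 S] [Algebra ℚ S]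

variable (𝕜) in
theorem derivation_eq_of_derivation_exp (δ : S →+ S)
    (hδ : ∀ a b, δ (a * b) = δ a * b + a * δ b) {Z c : S} {M : ℕ} (hZ : Z ^ M = 0)
    (hA : LieAlgebra.ad 𝕜 S Z ^ M = 0) (h : δ (IsNilpotent.exp Z) = IsNilpotent.exp Z * c) :
    δ Z = aeval (IsNilpotent.exp (LieAlgebra.ad 𝕜 S Z) - 1) (logDiv (M + 1))
      (IsNilpotent.exp (LieAlgebra.ad 𝕜 S Z) c) := by
  have hexp : aeval (LieAlgebra.ad 𝕜 S Z) (expDiv M) (δ Z)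
      = IsNilpotent.exp (LieAlgebra.ad 𝕜 S Z) c := by
    rw [exp_ad_apply ⟨M, hZ⟩, ← h, derivation_exp (𝕜 := 𝕜) δ hδ hZ hA, mul_assoc,
      IsNilpotent.exp_mul_exp_neg_self ⟨M, hZ⟩, mul_one]
  rw [← hexp, ← Module.End.mul_apply, aeval_logDiv_mul_aeval_expDiv hA, Module.End.one_apply]

theorem derivation_exp_mul_exp (δ : S →+ S) (hδ : ∀ a b, δ (a * b) = δ a * b + a * δ b) {α β : S}
    (hα : IsNilpotent α) (hβ : IsNilpotent β) (hδα : δ α = 0) (hc : Commute β (δ β)) :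
    δ (IsNilpotent.exp α * IsNilpotent.exp β) = IsNilpotent.exp α * IsNilpotent.exp β * δ β := by
  have hcexp : δ β * IsNilpotent.exp β = IsNilpotent.exp β * δ β := by
    obtain ⟨n, hn⟩ := hβ
    rw [IsNilpotent.exp_eq_sum hn]
    exact Commute.sum_right _ _ _ fun i _ => (hc.symm.pow_right i).smul_right _
  rw [hδ, derivation_exp_of_commute δ hδ hα (by rw [hδα]; exact Commute.zero_right α), hδα,
    derivation_exp_of_commute δ hδ hβ hc, hcexp]
  simp only [zero_mul, zero_add, mul_assoc]

theorem derivation_eq_sum_adWord (δ : S →+ S) (hδ : ∀ a b, δ (a * b) = δ a * b + a * δ b)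
    {α β Z : S} {n M : ℕ} (hα : α ^ n = 0) (hβ : β ^ n = 0) (hZ : Z ^ n = 0) (hM : 2 * n < M)
    (hexp : IsNilpotent.exp Z = IsNilpotent.exp α * IsNilpotent.exp β) (hδα : δ α = 0)
    (hc : Commute β (δ β)) :
    δ Z = ∑ k ∈ Finset.range M, ∑ p ∈ Fintype.piFinset (fun _ : Fin k => bchExponents M),
      ∑ m ∈ Finset.range M, (((∑ i, ((p i).2 : 𝕜)) + 1) * bchCoeff 𝕜 p m) •
        adWord 𝕜 α β (List.ofFn p) ((LieAlgebra.ad 𝕜 S α ^ m) (δ β)) := by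
  obtain ⟨K, rfl⟩ : ∃ K, M = K + 1 := ⟨M - 1, by lia⟩
  have had {z : S} (hz : z ^ n = 0) {L : ℕ} (hL : 2 * n ≤ L) : LieAlgebra.ad 𝕜 S z ^ L = 0 :=
    pow_eq_zero_of_le hL (ad_pow_eq_zero hz)
  have hδZ := derivation_eq_of_derivation_exp 𝕜 δ hδ (c := δ β)
    (pow_eq_zero_of_le (by lia : n ≤ K) hZ) (had hZ (by lia))
    (by rw [hexp, derivation_exp_mul_exp δ hδ ⟨n, hα⟩ ⟨n, hβ⟩ hδα hc])
  rw [hδZ, exp_ad_eq_mul ⟨n, hα⟩ ⟨n, hβ⟩ ⟨n, hZ⟩ hexp, Module.End.mul_apply,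
    exp_ad_apply_of_commute ⟨n, hβ⟩ hc, aeval_logDiv_exp_mul_exp_sub_one (𝕜 := 𝕜) K.succ_pos
    (had hα hM.le) (had hβ hM.le), exp_eq_sum_smul (𝕜 := 𝕜) (had hα hM.le)]
  simp only [LinearMap.sum_apply (Finset.range _), LinearMap.sum_apply (Fintype.piFinset _),
    LinearMap.smul_apply, ← adWord_ofFn]
  refine Finset.sum_congr rfl fun k _ => Finset.sum_congr rfl fun p _ => ?_
  rw [map_sum, Finset.smul_sum]
  refine Finset.sum_congr rfl fun m _ => ?_
  rw [map_smul, smul_smul]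
  have hne : (∑ i, ((p i).2 : 𝕜)) + 1 ≠ 0 := by exact_mod_cast Nat.succ_ne_zero (∑ i, (p i).2)
  rw [bchCoeff]
  congr 1
  field_simp

end Derivation

section AdPolynomial

variable {𝕜 : Type*} [CommRing 𝕜] {R : Type*} [Ring R] [Algebra 𝕜 R]

theorem ad_C_pow_monomial (a c : R) (r n : ℕ) :
    (LieAlgebra.ad 𝕜 R[X] (C a) ^ n) (monomial r c)
      = monomial r ((LieAlgebra.ad 𝕜 R a ^ n) c) := by
  induction n with
  | zero => rfl
  | succ n ih =>
    rw [pow_succ', pow_succ', Module.End.mul_apply, ih]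
    simp [LieRing.of_associative_ring_bracket, C_mul_monomial, monomial_mul_C]

theorem ad_X_mul_C_pow_monomial (b c : R) (r n : ℕ) :
    (LieAlgebra.ad 𝕜 R[X] (X * C b) ^ n) (monomial r c)
      = monomial (r + n) ((LieAlgebra.ad 𝕜 R b ^ n) c) := by
  induction n with
  | zero => rfl
  | succ n ih =>
    rw [pow_succ', pow_succ', Module.End.mul_apply, ih]
    simp [LieRing.of_associative_ring_bracket, X_mul_C, C_mul_X_eq_monomial, monomial_mul_monomial,
      ← add_assoc, add_comm 1]

theorem adWord_monomial (a b c : R) (r : ℕ) (l : List (ℕ × ℕ)) :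
    adWord 𝕜 (C a) (X * C b) l (monomial r c)
      = monomial (r + (l.map Prod.snd).sum) (adWord 𝕜 a b l c) := by
  induction l with
  | nil => simp [adWord]
  | cons q l ih =>
    simp only [adWord, List.map_cons, List.prod_cons, Module.End.mul_apply, List.sum_cons]
      at ih ⊢
    rw [ih, ad_X_mul_C_pow_monomial, ad_C_pow_monomial, add_assoc, add_comm q.2]

theorem eq_of_derivative_eq [Algebra ℚ R] {p q : R[X]} (h : derivative p = derivative q)
    (h0 : p.coeff 0 = q.coeff 0) : p = q := by
  ext n
  rcases n with _ | n
  · exact h0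
  have hcoeff := congrArg (coeff · n) h
  simp only [coeff_derivative] at hcoeff
  have hu : IsUnit ((n : R) + 1) := by
    simpa using (IsUnit.mk0 ((n : ℚ) + 1) (by positivity)).map (algebraMap ℚ R)
  exact hu.mul_right_cancel hcoeff

end AdPolynomial

theorem map_exp_mul_exp {A B F : Type*} [Ring A] [Ring B] [Algebra ℚ A] [Algebra ℚ B]
    [FunLike F A B] [RingHomClass F A B] {a b : A} (ha : IsNilpotent a) (hb : IsNilpotent b)
    (f : F) :
    f (IsNilpotent.exp a * IsNilpotent.exp b) = IsNilpotent.exp (f a) * IsNilpotent.exp (f b) := by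
  rw [map_mul, IsNilpotent.map_exp ha, IsNilpotent.map_exp hb]

variable {𝕜 : Type*} [RCLike 𝕜] {R : Type*} [Ring R] [Algebra 𝕜 R]

theorem bch_C_X_mul_C (M : ℕ) (a b : R) :
    bch 𝕜 M (C a) (X * C b) = C a + ∑ k ∈ Finset.range M,
      ∑ p ∈ Fintype.piFinset (fun _ : Fin k => bchExponents M), ∑ m ∈ Finset.range M,
        monomial ((∑ i, (p i).2) + 1)
          (bchCoeff 𝕜 p m • adWord 𝕜 a b (List.ofFn p) ((LieAlgebra.ad 𝕜 R a ^ m) b)) := by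
  have had (m : ℕ) : (LieAlgebra.ad 𝕜 R[X] (C a) ^ m) (X * C b)
      = monomial 1 ((LieAlgebra.ad 𝕜 R a ^ m) b) := by
    rw [X_mul_C, C_mul_X_eq_monomial, ad_C_pow_monomial]
  simp only [bch_eq_sum, had, adWord_monomial, smul_monomial, List.map_ofFn, List.sum_ofFn,
    Function.comp_apply, add_comm 1]

theorem derivative_bch_C_X_mul_C (M : ℕ) (a b : R) :
    derivative (bch 𝕜 M (C a) (X * C b)) = ∑ k ∈ Finset.range M,
      ∑ p ∈ Fintype.piFinset (fun _ : Fin k => bchExponents M), ∑ m ∈ Finset.range M,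
        (((∑ i, ((p i).2 : 𝕜)) + 1) * bchCoeff 𝕜 p m) •
          adWord 𝕜 (C a) (X * C b) (List.ofFn p) ((LieAlgebra.ad 𝕜 R[X] (C a) ^ m) (C b)) := by
  have had (m : ℕ) : (LieAlgebra.ad 𝕜 R[X] (C a) ^ m) (C b)
      = monomial 0 ((LieAlgebra.ad 𝕜 R a ^ m) b) := by
    rw [← ad_C_pow_monomial, monomial_zero_left]
  rw [bch_C_X_mul_C, derivative_add, derivative_C, zero_add]
  simp only [derivative_sum, derivative_monomial, had, adWord_monomial, List.map_ofFn,
    List.sum_ofFn, Function.comp_apply, zero_add, Nat.add_sub_cancel, smul_monomial, mul_smul,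
    ← nsmul_eq_mul', ← Nat.cast_smul_eq_nsmul 𝕜]
  simp only [Nat.cast_add, Nat.cast_sum, Nat.cast_one]

theorem C_pow_eq_zero {a : R} {n : ℕ} (ha : a ^ n = 0) : (C a : R[X]) ^ n = 0 := by
  rw [← C_pow, ha, C_0]

theorem X_mul_C_pow_eq_zero {b : R} {n : ℕ} (hb : b ^ n = 0) : (X * C b : R[X]) ^ n = 0 := by
  rw [(commute_X (C b)).mul_pow, C_pow_eq_zero hb, mul_zero]

variable [Algebra ℚ R]

-- Both sides are polynomials in `X` with the same derivative and the same value at `0`.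
theorem nilLog_exp_C_mul_exp_X_mul_C {a b : R} {n M : ℕ} (ha : a ^ n = 0) (hb : b ^ n = 0)
    (hW : (IsNilpotent.exp (C a) * IsNilpotent.exp (X * C b) - 1) ^ n = 0) (hM : 2 * n < M) :
    nilLog (n + 1) (IsNilpotent.exp (C a) * IsNilpotent.exp (X * C b) - 1)
      = bch 𝕜 M (C a) (X * C b) := by
  set W : R[X] := IsNilpotent.exp (C a) * IsNilpotent.exp (X * C b) with hWdef
  have hexp : IsNilpotent.exp (nilLog (n + 1) (W - 1)) = W := by
    rw [exp_nilLog (pow_eq_zero_of_le n.le_succ hW), add_sub_cancel]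
  have hdβ : derivative (X * C b) = C b := by simp
  have hc : Commute (X * C b) (C b) := (commute_X (C b)).mul_left (Commute.refl _)
  refine eq_of_derivative_eq ?_ ?_
  · rw [derivative_bch_C_X_mul_C]
    simpa [hdβ] using derivation_eq_sum_adWord (𝕜 := 𝕜)
      (derivative : R[X] →ₗ[R] R[X]).toAddMonoidHom (fun p q => derivative_mul)
      (C_pow_eq_zero ha) (X_mul_C_pow_eq_zero hb) (nilLog_pow_eq_zero hW _) hM hexp derivative_C
      (by simpa [hdβ] using hc)
  · have hW0 : constantCoeff W = IsNilpotent.exp a := by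
      rw [hWdef, map_exp_mul_exp ⟨n, C_pow_eq_zero ha⟩ ⟨n, X_mul_C_pow_eq_zero hb⟩]
      simp
    calc (nilLog (n + 1) (W - 1)).coeff 0
        = nilLog (n + 1) (constantCoeff W - 1) := by
          simpa using map_nilLog (constantCoeff : R[X] →+* R).toRatAlgHom (n + 1) (W - 1)
      _ = (bch 𝕜 M (C a) (X * C b)).coeff 0 := by
          rw [hW0, nilLog_exp ha, bch_C_X_mul_C]
          simp [coeff_monomial]

theorem exp_bch {a b : R} {n M : ℕ} (ha : a ^ n = 0) (hb : b ^ n = 0)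
    (hW : (IsNilpotent.exp (C a) * IsNilpotent.exp (X * C b) - 1) ^ n = 0) (hM : 2 * n < M) :
    IsNilpotent.exp (bch 𝕜 M a b) = IsNilpotent.exp a * IsNilpotent.exp b ∧
      bch 𝕜 M a b ^ n = 0 := by
  have hZ := nilLog_exp_C_mul_exp_X_mul_C (𝕜 := 𝕜) ha hb hW hM
  have hZn := nilLog_pow_eq_zero hW (n + 1)
  have hexp := exp_nilLog (pow_eq_zero_of_le n.le_succ hW)
  rw [hZ] at hZn hexp
  let ev : R[X] →ₐ[𝕜] R := eval₂AlgHom (AlgHom.id 𝕜 R) 1 fun r => Commute.one_right r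
  have hevC (r : R) : ev (C r) = r := eval₂_C _ _
  have hevX : ev (X * C b) = b := by
    rw [map_mul, show ev X = 1 from eval₂_X _ _, hevC, one_mul]
  have hev : ev (bch 𝕜 M (C a) (X * C b)) = bch 𝕜 M a b := by
    have := map_bch (ev : R[X] →ₗ⁅𝕜⁆ R) M (C a) (X * C b)
    rwa [AlgHom.coe_toLieHom, hevC, hevX] at this
  rw [← hev]
  constructor
  · rw [← IsNilpotent.map_exp ⟨n, hZn⟩, hexp, add_sub_cancel,
      map_exp_mul_exp ⟨n, C_pow_eq_zero ha⟩ ⟨n, X_mul_C_pow_eq_zero hb⟩, hevC, hevX]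
  · rw [← map_pow, hZn, map_zero]

end Dynkin

/-! ### The Baker-Campbell-Hausdorff product on a nilpotent Lie algebra -/

section NilpotentBCH

theorem mem_bchExponents {N : ℕ} {q : ℕ × ℕ} :
    q ∈ bchExponents N ↔ q ≠ (0, 0) ∧ q.1 < N ∧ q.2 < N := by
  simp [bchExponents]

theorem length_le_sum_of_mem_bchExponents {M k : ℕ} {p : Fin k → ℕ × ℕ}
    (hp : ∀ i, p i ∈ bchExponents M) : k ≤ ∑ i, ((p i).1 + (p i).2) := by
  have hpos (i : Fin k) : 1 ≤ (p i).1 + (p i).2 := by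
    by_contra h
    exact (mem_bchExponents.mp (hp i)).1 (Prod.ext (by lia) (by lia))
  calc k = ∑ _i : Fin k, 1 := by simp
    _ ≤ ∑ i, ((p i).1 + (p i).2) := Finset.sum_le_sum fun i _ => hpos i

theorem exists_le_sum_of_notMem_bchExponents {M N k : ℕ} {p : Fin k → ℕ × ℕ}
    (hp : ∀ i, p i ∈ bchExponents M) (hp' : ¬∀ i, p i ∈ bchExponents N) :
    N ≤ ∑ i, ((p i).1 + (p i).2) := by
  obtain ⟨i, hi⟩ := not_forall.mp hp'
  have hle : (p i).1 + (p i).2 ≤ ∑ i, ((p i).1 + (p i).2) :=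
    Finset.single_le_sum (f := fun i => (p i).1 + (p i).2) (fun _ _ => Nat.zero_le _)
      (Finset.mem_univ i)
  have := (mem_bchExponents.mp (hp i)).1
  rw [mem_bchExponents] at hi
  lia

/-- A decreasing filtration of a Lie algebra that is raised by all inner derivations and
terminates after `N` steps. -/
structure LieFiltration (𝕜 : Type*) [CommRing 𝕜] (𝔤 : Type*) [LieRing 𝔤] [LieAlgebra 𝕜 𝔤]
    (N : ℕ) where
  toFun : ℕ → Submodule 𝕜 𝔤
  antitone : Antitone toFun
  zero_eq_top : toFun 0 = ⊤
  eq_bot : toFun N = ⊥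
  lie_mem : ∀ k (x m : 𝔤), m ∈ toFun k → ⁅x, m⁆ ∈ toFun (k + 1)

namespace LieFiltration

section CommRing

variable {𝕜 𝔤 : Type*} [CommRing 𝕜] [LieRing 𝔤] [LieAlgebra 𝕜 𝔤] {N : ℕ}

/-- The lower central series of a nilpotent Lie algebra. -/
def ofLowerCentralSeries (h : LieModule.lowerCentralSeries 𝕜 𝔤 𝔤 N = ⊥) :
    LieFiltration 𝕜 𝔤 N where
  toFun k := (LieModule.lowerCentralSeries 𝕜 𝔤 𝔤 k).toSubmodule
  antitone _ _ hij := LieModule.antitone_lowerCentralSeries 𝕜 𝔤 𝔤 hij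
  zero_eq_top := by simp
  eq_bot := by simp [h]
  lie_mem k x m hm := by
    rw [LieModule.lowerCentralSeries_succ]
    exact LieSubmodule.lie_mem_lie (LieSubmodule.mem_top x) hm

theorem ad_pow_mem (V : LieFiltration 𝕜 𝔤 N) (x : 𝔤) {m : 𝔤} {k : ℕ} (hm : m ∈ V.toFun k) (n : ℕ) :
    (LieAlgebra.ad 𝕜 𝔤 x ^ n) m ∈ V.toFun (k + n) := by
  induction n with
  | zero => exact hm
  | succ n ih => rw [pow_succ', Module.End.mul_apply]; exact V.lie_mem _ _ _ ih

theorem adWord_mem (V : LieFiltration 𝕜 𝔤 N) (x y : 𝔤) {z : 𝔤} {k : ℕ} (hz : z ∈ V.toFun k)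
    (l : List (ℕ × ℕ)) :
    adWord 𝕜 x y l z ∈ V.toFun (k + (l.map fun q => q.1 + q.2).sum) := by
  induction l with
  | nil => exact hz
  | cons q l ih =>
    simp only [adWord, List.map_cons, List.prod_cons, Module.End.mul_apply, List.sum_cons] at ih ⊢
    convert V.ad_pow_mem x (V.ad_pow_mem y ih q.2) q.1 using 2
    ring

theorem eq_zero_of_mem (V : LieFiltration 𝕜 𝔤 N) {z : 𝔤} {k : ℕ} (hz : z ∈ V.toFun k)
    (hk : N ≤ k) : z = 0 := by
  have := V.antitone hk hz
  rwa [V.eq_bot, Submodule.mem_bot] at this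

theorem adWord_ofFn_apply_eq_zero (V : LieFiltration 𝕜 𝔤 N) (x y z : 𝔤) {k m : ℕ}
    {p : Fin k → ℕ × ℕ} (h : N ≤ m + ∑ i, ((p i).1 + (p i).2)) :
    adWord 𝕜 x y (List.ofFn p) ((LieAlgebra.ad 𝕜 𝔤 x ^ m) z) = 0 := by
  have hz : z ∈ V.toFun 0 := by rw [V.zero_eq_top]; trivial
  refine V.eq_zero_of_mem (V.adWord_mem x y (V.ad_pow_mem x hz m) _) ?_
  rw [List.map_ofFn, List.sum_ofFn, zero_add]
  exact h

end CommRing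

variable {𝕜 𝔤 : Type*} [RCLike 𝕜] [LieRing 𝔤] [LieAlgebra 𝕜 𝔤] {N : ℕ}

theorem bch_eq_of_le (V : LieFiltration 𝕜 𝔤 N) {M : ℕ} (hM : N ≤ M) (x y : 𝔤) :
    bch 𝕜 M x y = bch 𝕜 N x y := by
  have hzero {k m : ℕ} {p : Fin k → ℕ × ℕ} (h : N ≤ m + ∑ i, ((p i).1 + (p i).2)) :
      bchCoeff 𝕜 p m • adWord 𝕜 x y (List.ofFn p) ((LieAlgebra.ad 𝕜 𝔤 x ^ m) y) = 0 := by
    rw [V.adWord_ofFn_apply_eq_zero x y y h, smul_zero]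
  have hexponents : bchExponents N ⊆ bchExponents M := fun q hq => by
    rw [mem_bchExponents] at hq ⊢
    lia
  rw [bch_eq_sum, bch_eq_sum]
  refine congrArg (x + ·) (Finset.sum_subset_zero_on_sdiff (Finset.range_mono hM) ?_ ?_).symm
  · refine fun k hk => Finset.sum_eq_zero fun p hp => Finset.sum_eq_zero fun m _ => hzero ?_
    have := length_le_sum_of_mem_bchExponents (Fintype.mem_piFinset.mp hp)
    simp only [Finset.mem_sdiff, Finset.mem_range] at hk
    lia
  refine fun k _ => Finset.sum_subset_zero_on_sdiff
    (Fintype.piFinset_subset _ _ fun _ => hexponents) ?_ ?_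
  · refine fun p hp => Finset.sum_eq_zero fun m _ => hzero ?_
    simp only [Finset.mem_sdiff, Fintype.mem_piFinset] at hp
    exact le_add_left (exists_le_sum_of_notMem_bchExponents hp.1 hp.2)
  refine fun p _ => Finset.sum_subset_zero_on_sdiff (Finset.range_mono hM) ?_ fun _ _ => rfl
  intro m hm
  simp only [Finset.mem_sdiff, Finset.mem_range] at hm
  exact hzero (by lia)

end LieFiltration

variable {𝕜 𝔤 : Type*} [RCLike 𝕜] [LieRing 𝔤] [LieAlgebra 𝕜 𝔤]

theorem bch_of_isLieAbelian [IsLieAbelian 𝔤] {N : ℕ} (hN : 1 ≤ N) (x y : 𝔤) :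
    bch 𝕜 N x y = x + y := by
  have h : LieModule.lowerCentralSeries 𝕜 𝔤 𝔤 1 = ⊥ :=
    (LieModule.trivial_iff_lower_central_eq_bot 𝕜 𝔤 𝔤).mp inferInstance
  rw [(LieFiltration.ofLowerCentralSeries h).bch_eq_of_le hN, bch_eq_sum]
  simp [bchCoeff, adWord]

theorem bch_of_lie_eq_zero {N : ℕ} (hN : 1 ≤ N) {x y : 𝔤} (h : ⁅x, y⁆ = 0) :
    bch 𝕜 N x y = x + y := by
  let K := LieSubalgebra.lieSpan 𝕜 𝔤 {x, y}
  have hx : x ∈ K := LieSubalgebra.subset_lieSpan (by simp)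
  have hy : y ∈ K := LieSubalgebra.subset_lieSpan (by simp)
  have : IsLieAbelian K := LieSubalgebra.isLieAbelian_lieSpan_iff.mpr <| by
    simp [h, ← lie_skew y x]
  have hK := map_bch K.incl N ⟨x, hx⟩ ⟨y, hy⟩
  rw [bch_of_isLieAbelian hN] at hK
  exact hK.symm

end NilpotentBCH

/-! ### Operators that raise a filtration -/

section RaisingOperators

open Polynomial

section Field

variable {𝕜 W : Type*} [Field 𝕜] [AddCommGroup W] [Module 𝕜 W] {U : ℕ → Submodule 𝕜 W}

/-- The operators that raise the filtration `U` by `i` steps. -/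
def raising (U : ℕ → Submodule 𝕜 W) (i : ℕ) : Submodule 𝕜 (Module.End 𝕜 W) where
  carrier := {T | ∀ k, ∀ v ∈ U k, T v ∈ U (k + i)}
  add_mem' hS hT k v hv := (U _).add_mem (hS k v hv) (hT k v hv)
  zero_mem' _ _ _ := (U _).zero_mem
  smul_mem' c _ hT k v hv := (U _).smul_mem c (hT k v hv)

theorem mul_mem_raising {i j : ℕ} {S T : Module.End 𝕜 W} (hS : S ∈ raising U i)
    (hT : T ∈ raising U j) : S * T ∈ raising U (i + j) := by
  intro k v hv
  rw [show k + (i + j) = k + j + i by lia]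
  exact hS _ _ (hT k v hv)

theorem raising_antitone (hU : Antitone U) : Antitone (raising U) :=
  fun _ _ hij _ hT k v hv => hU (Nat.add_le_add_left hij k) (hT k v hv)

theorem coeff_C_mem_raising {i : ℕ} {T : Module.End 𝕜 W} (hT : T ∈ raising U i) (n : ℕ) :
    (C T).coeff n ∈ raising U i := by
  rw [coeff_C]
  split_ifs
  exacts [hT, Submodule.zero_mem _]

theorem coeff_X_mul_C_mem_raising {i : ℕ} {T : Module.End 𝕜 W} (hT : T ∈ raising U i) (n : ℕ) :
    (X * C T).coeff n ∈ raising U i := by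
  rw [X_mul_C, coeff_C_mul_X]
  split_ifs
  exacts [hT, Submodule.zero_mem _]

theorem coeff_mul_mem_raising {i j : ℕ} {p q : (Module.End 𝕜 W)[X]}
    (hp : ∀ n, p.coeff n ∈ raising U i) (hq : ∀ n, q.coeff n ∈ raising U j) (n : ℕ) :
    (p * q).coeff n ∈ raising U (i + j) := by
  rw [coeff_mul]
  exact Submodule.sum_mem _ fun x _ => mul_mem_raising (hp _) (hq _)

theorem coeff_pow_mem_raising {p : (Module.End 𝕜 W)[X]} (hp : ∀ n, p.coeff n ∈ raising U 1)
    (k n : ℕ) : (p ^ k).coeff n ∈ raising U k := by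
  induction k generalizing n with
  | zero =>
    rw [pow_zero, ← C_1]
    exact coeff_C_mem_raising (fun _ _ => id) n
  | succ k ih => rw [pow_succ]; exact coeff_mul_mem_raising ih hp n

variable {N : ℕ}

theorem pow_eq_zero_of_coeff_mem_raising (h₀ : U 0 = ⊤) (hN : U N = ⊥) {p : (Module.End 𝕜 W)[X]}
    (hp : ∀ n, p.coeff n ∈ raising U 1) : p ^ N = 0 := by
  ext n v
  have := coeff_pow_mem_raising hp N n 0 v (by rw [h₀]; trivial)
  rw [zero_add, hN, Submodule.mem_bot] at this
  simpa using this

theorem pow_eq_zero_of_mem_raising (h₀ : U 0 = ⊤) (hN : U N = ⊥) {T : Module.End 𝕜 W}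
    (hT : T ∈ raising U 1) : T ^ N = 0 :=
  C_eq_zero.mp <| C_pow (R := Module.End 𝕜 W) ▸
    pow_eq_zero_of_coeff_mem_raising h₀ hN (coeff_C_mem_raising hT)

variable [CharZero 𝕜] [Algebra ℚ (Module.End 𝕜 W)]

theorem coeff_exp_sub_one_mem_raising (hU : Antitone U) (h₀ : U 0 = ⊤) (hN : U N = ⊥)
    {p : (Module.End 𝕜 W)[X]} (hp : ∀ n, p.coeff n ∈ raising U 1) (n : ℕ) :
    (IsNilpotent.exp p - 1).coeff n ∈ raising U 1 := by
  have hpN := pow_eq_zero_of_coeff_mem_raising h₀ hN hp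
  rw [IsNilpotent.exp_eq_sum (pow_eq_zero_of_le N.le_succ hpN), Finset.sum_range_succ']
  simp only [pow_zero, Nat.factorial_zero, Nat.cast_one, inv_one, one_smul, add_sub_cancel_right,
    finsetSum_coeff, coeff_smul]
  refine Submodule.sum_mem _ fun i _ => ?_
  rw [← Rat.cast_smul_eq_qsmul 𝕜]
  exact Submodule.smul_mem _ _ (raising_antitone hU (by lia) (coeff_pow_mem_raising hp (i + 1) n))

theorem exp_mul_exp_sub_one_pow_eq_zero (hU : Antitone U) (h₀ : U 0 = ⊤) (hN : U N = ⊥)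
    {p q : (Module.End 𝕜 W)[X]} (hp : ∀ n, p.coeff n ∈ raising U 1)
    (hq : ∀ n, q.coeff n ∈ raising U 1) :
    (IsNilpotent.exp p * IsNilpotent.exp q - 1) ^ N = 0 := by
  refine pow_eq_zero_of_coeff_mem_raising h₀ hN fun n => ?_
  have hp' := coeff_exp_sub_one_mem_raising hU h₀ hN hp
  have hq' := coeff_exp_sub_one_mem_raising hU h₀ hN hq
  rw [show IsNilpotent.exp p * IsNilpotent.exp q - 1
      = (IsNilpotent.exp p - 1) * (IsNilpotent.exp q - 1) + (IsNilpotent.exp p - 1)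
        + (IsNilpotent.exp q - 1) by
        rw [sub_mul, mul_sub, one_mul, mul_one]; abel, coeff_add, coeff_add]
  exact Submodule.add_mem _ (Submodule.add_mem _
    (raising_antitone hU (by lia) (coeff_mul_mem_raising hp' hq' n)) (hp' n)) (hq' n)

end Field

attribute [local instance] LieRing.ofAssociativeRing

theorem exp_bch_of_mem_raising {𝕜 W : Type*} [RCLike 𝕜] [AddCommGroup W] [Module 𝕜 W]
    [Algebra ℚ (Module.End 𝕜 W)] {U : ℕ → Submodule 𝕜 W} {N M : ℕ} (hU : Antitone U)
    (h₀ : U 0 = ⊤) (hN : U N = ⊥) {a b : Module.End 𝕜 W} (ha : a ∈ raising U 1)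
    (hb : b ∈ raising U 1) (hM : 2 * N < M) :
    IsNilpotent.exp (bch 𝕜 M a b) = IsNilpotent.exp a * IsNilpotent.exp b :=
  (exp_bch (pow_eq_zero_of_mem_raising h₀ hN ha) (pow_eq_zero_of_mem_raising h₀ hN hb)
    (exp_mul_exp_sub_one_pow_eq_zero hU h₀ hN (coeff_C_mem_raising ha)
      (coeff_X_mul_C_mem_raising hb)) hM).1

end RaisingOperators

/-! ### The group law -/

section ExpAdTruncated

attribute [local instance] LieRing.ofAssociativeRing

/-- `e^{ad x} y`, truncated after `M` terms. -/
def expAd (𝕜 : Type*) [RCLike 𝕜] {𝔤 : Type*} [LieRing 𝔤] [LieAlgebra 𝕜 𝔤] (M : ℕ) (x y : 𝔤) : 𝔤 :=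
  ∑ n ∈ Finset.range M, (n.factorial : 𝕜)⁻¹ • (LieAlgebra.ad 𝕜 𝔤 x ^ n) y

variable {𝕜 : Type*} [RCLike 𝕜]

theorem map_expAd {𝔤 𝔥 : Type*} [LieRing 𝔤] [LieAlgebra 𝕜 𝔤] [LieRing 𝔥] [LieAlgebra 𝕜 𝔥]
    (f : 𝔤 →ₗ⁅𝕜⁆ 𝔥) (M : ℕ) (x y : 𝔤) : f (expAd 𝕜 M x y) = expAd 𝕜 M (f x) (f y) := by
  simp only [expAd, map_sum, map_smul, map_ad_pow_apply]

theorem expAd_eq_conj {R : Type*} [Ring R] [Algebra 𝕜 R] [Algebra ℚ R] {a : R} {n M : ℕ}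
    (ha : a ^ n = 0) (hM : 2 * n ≤ M) (b : R) :
    expAd 𝕜 M a b = IsNilpotent.exp a * b * IsNilpotent.exp (-a) := by
  rw [← exp_ad_apply (𝕜 := 𝕜) ⟨n, ha⟩, IsNilpotent.exp_eq_sum
    (pow_eq_zero_of_le hM (ad_pow_eq_zero ha)), expAd, LinearMap.sum_apply]
  refine Finset.sum_congr rfl fun n _ => ?_
  rw [LinearMap.smul_apply, ← Rat.cast_smul_eq_qsmul 𝕜]
  push_cast
  rfl

theorem exp_conj_exp {R : Type*} [Ring R] [Algebra ℚ R] {a b : R} (ha : IsNilpotent a)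
    (hb : IsNilpotent b) :
    IsNilpotent.exp (IsNilpotent.exp a * b * IsNilpotent.exp (-a))
      = IsNilpotent.exp a * IsNilpotent.exp b * IsNilpotent.exp (-a) := by
  let u : Rˣ := ⟨IsNilpotent.exp a, IsNilpotent.exp (-a), IsNilpotent.exp_mul_exp_neg_self ha,
    IsNilpotent.exp_neg_mul_exp_self ha⟩
  exact IsNilpotent.exp_smul (ConjAct.toConjAct u) hb

end ExpAdTruncated

section DerivationRepresentation

attribute [local instance] LieRing.ofAssociativeRing

/-- The restriction to `𝔥` of the adjoint representation of the semidirect product `𝔥 ⋊ 𝕜 E`, for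
a derivation `E`. -/
def derivationRep {𝕜 𝔥 : Type*} [CommRing 𝕜] [LieRing 𝔥] [LieAlgebra 𝕜 𝔥]
    (E : LieDerivation 𝕜 𝔥 𝔥) : 𝔥 →ₗ⁅𝕜⁆ Module.End 𝕜 (𝔥 × 𝕜) where
  toFun l := LinearMap.inl 𝕜 𝔥 𝕜 ∘ₗ
    (LieAlgebra.ad 𝕜 𝔥 l).coprod (LinearMap.toSpanSingleton 𝕜 𝔥 (E l))
  map_add' l l' := by ext <;> simp
  map_smul' c l := by ext <;> simp
  map_lie' {l l'} := by ext <;> simp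

variable {𝕜 𝔥 : Type*} [RCLike 𝕜] [LieRing 𝔥] [LieAlgebra 𝕜 𝔥]

theorem derivationRep_apply (E : LieDerivation 𝕜 𝔥 𝔥) (l : 𝔥) (m : 𝔥 × 𝕜) :
    derivationRep E l m = (⁅l, m.1⁆ + m.2 • E l, 0) := by
  simp [derivationRep]

/-- The filtration of `𝔥 × 𝕜` that is raised by `derivationRep`. -/
def LieFiltration.extend {N : ℕ} (V : LieFiltration 𝕜 𝔥 N) : ℕ → Submodule 𝕜 (𝔥 × 𝕜)
  | 0 => ⊤
  | k + 1 => (V.toFun k).prod ⊥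

variable {N : ℕ} (V : LieFiltration 𝕜 𝔥 N)

theorem LieFiltration.extend_antitone : Antitone V.extend := by
  refine antitone_nat_of_succ_le fun k => ?_
  rcases k with _ | k
  · exact le_top
  · exact Submodule.prod_mono (V.antitone k.le_succ) le_rfl

theorem LieFiltration.extend_succ_eq_bot : V.extend (N + 1) = ⊥ := by
  simp [LieFiltration.extend, V.eq_bot]

variable (E : LieDerivation 𝕜 𝔥 𝔥)

theorem derivationRep_mem_raising (l : 𝔥) : derivationRep E l ∈ raising V.extend 1 := by
  intro k v hv
  rw [derivationRep_apply]
  refine Submodule.mem_prod.mpr ⟨?_, Submodule.zero_mem _⟩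
  rcases k with _ | k
  · rw [V.zero_eq_top]; trivial
  · obtain ⟨h₁, h₂⟩ := Submodule.mem_prod.mp hv
    rw [(Submodule.mem_bot 𝕜).mp h₂, zero_smul, add_zero]
    exact V.lie_mem _ _ _ h₁

include V

theorem derivationRep_pow_eq_zero (x : 𝔥) : derivationRep E x ^ (N + 1) = 0 :=
  pow_eq_zero_of_mem_raising rfl V.extend_succ_eq_bot (derivationRep_mem_raising V E x)

variable [Algebra ℚ (Module.End 𝕜 (𝔥 × 𝕜))]

theorem exp_derivationRep_bch {M : ℕ} (hM : 2 * (N + 1) < M) (x y : 𝔥) :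
    IsNilpotent.exp (derivationRep E (bch 𝕜 M x y))
      = IsNilpotent.exp (derivationRep E x) * IsNilpotent.exp (derivationRep E y) := by
  rw [map_bch]
  exact exp_bch_of_mem_raising V.extend_antitone rfl V.extend_succ_eq_bot
    (derivationRep_mem_raising V E x) (derivationRep_mem_raising V E y) hM

theorem eq_of_exp_derivationRep_eq {x y : 𝔥}
    (h : IsNilpotent.exp (derivationRep E x) = IsNilpotent.exp (derivationRep E y)) :
    E x = E y := by
  have h' := exp_injective_of_isNilpotent ⟨_, derivationRep_pow_eq_zero V E x⟩
    ⟨_, derivationRep_pow_eq_zero V E y⟩ h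
  simpa [derivationRep_apply] using congrArg Prod.fst (LinearMap.congr_fun h' (0, 1))

theorem derivation_bch_assoc {M : ℕ} (hM : 2 * (N + 1) < M) (x y z : 𝔥) :
    E (bch 𝕜 M (bch 𝕜 M x y) z) = E (bch 𝕜 M x (bch 𝕜 M y z)) := by
  refine eq_of_exp_derivationRep_eq V E ?_
  simp only [exp_derivationRep_bch V E hM, mul_assoc]

theorem derivation_bch_conj {M : ℕ} (hM : 2 * (N + 1) < M) (x y : 𝔥) :
    E (bch 𝕜 M (bch 𝕜 M x y) (-x)) = E (expAd 𝕜 M x y) := by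
  refine eq_of_exp_derivationRep_eq V E ?_
  have hx := derivationRep_pow_eq_zero V E x
  rw [exp_derivationRep_bch V E hM, exp_derivationRep_bch V E hM, map_neg, map_expAd,
    expAd_eq_conj hx hM.le, exp_conj_exp ⟨_, hx⟩ ⟨_, derivationRep_pow_eq_zero V E y⟩]

end DerivationRepresentation

section GroupLaw

open Polynomial TensorProduct

section BaseChange

variable {𝕜 𝔤 : Type*} [CommRing 𝕜] [LieRing 𝔤] [LieAlgebra 𝕜 𝔤] (A : Type*) [CommRing A]
  [Algebra 𝕜 A]

/-- The extension of scalars of a filtration. -/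
def LieFiltration.baseChange {N : ℕ} (V : LieFiltration 𝕜 𝔤 N) : LieFiltration 𝕜 (A ⊗[𝕜] 𝔤) N where
  toFun k := ((V.toFun k).baseChange A).restrictScalars 𝕜
  antitone _ _ hij := Submodule.baseChange_mono A (V.antitone hij)
  zero_eq_top := by simp [V.zero_eq_top]
  eq_bot := by simp [V.eq_bot]
  lie_mem k x m hm := by
    rw [Submodule.restrictScalars_mem, Submodule.baseChange_eq_span] at hm ⊢
    induction hm using Submodule.span_induction with
    | mem m hm =>
      obtain ⟨m, hm, rfl⟩ := hm
      induction x using TensorProduct.induction_on with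
      | zero => rw [zero_lie]; exact Submodule.zero_mem _
      | tmul p x =>
        have := V.lie_mem k x m hm
        rw [TensorProduct.mk_apply, LieAlgebra.ExtendScalars.bracket_tmul, mul_one, ← mul_one p,
          ← smul_eq_mul, ← TensorProduct.smul_tmul']
        exact Submodule.smul_mem _ _ (Submodule.subset_span ⟨_, this, rfl⟩)
      | add x y hx hy => rw [add_lie]; exact Submodule.add_mem _ hx hy
    | zero => rw [lie_zero]; exact Submodule.zero_mem _
    | add m m' _ _ h h' => rw [lie_add]; exact Submodule.add_mem _ h h'
    | smul c m _ h => rw [lie_smul]; exact Submodule.smul_mem _ _ h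

variable {A}

/-- The homomorphism `A ⊗ 𝔤 → 𝔤` induced by a character of `A`. -/
def characterLieHom (χ : A →ₐ[𝕜] 𝕜) : A ⊗[𝕜] 𝔤 →ₗ⁅𝕜⁆ 𝔤 where
  toLinearMap := (TensorProduct.lid 𝕜 𝔤).toLinearMap ∘ₗ LinearMap.rTensor 𝔤 χ.toLinearMap
  map_lie' {x y} := by
    induction x using TensorProduct.induction_on with
    | zero => simp
    | add x x' hx hx' => simp_all [add_lie]
    | tmul p x =>
      induction y using TensorProduct.induction_on with
      | zero => simp
      | add y y' hy hy' => simp_all [lie_add]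
      | tmul q y => simp [mul_smul, smul_comm (χ p)]

theorem characterLieHom_tmul (χ : A →ₐ[𝕜] 𝕜) (p : A) (x : 𝔤) :
    characterLieHom χ (p ⊗ₜ[𝕜] x) = χ p • x := rfl

/-- The extension `D ⊗ id` to `A ⊗ 𝔤` of a derivation `D` of `A`. -/
def extendDerivation (𝔤 : Type*) [LieRing 𝔤] [LieAlgebra 𝕜 𝔤] (D : Derivation 𝕜 A A) :
    LieDerivation 𝕜 (A ⊗[𝕜] 𝔤) (A ⊗[𝕜] 𝔤) where
  toLinearMap := LinearMap.rTensor 𝔤 D.toLinearMap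
  leibniz' x y := by
    induction x using TensorProduct.induction_on with
    | zero => simp
    | add x x' hx hx' => simp only [add_lie, lie_add, map_add, hx, hx']; abel
    | tmul p x =>
      induction y using TensorProduct.induction_on with
      | zero => simp
      | add y y' hy hy' => simp only [add_lie, lie_add, map_add, hy, hy']; abel
      | tmul q y =>
        simp only [LinearMap.rTensor_tmul, LieAlgebra.ExtendScalars.bracket_tmul,
          Derivation.coeFn_coe, Derivation.leibniz,
          smul_eq_mul, TensorProduct.add_tmul]
        rw [← lie_skew y x, TensorProduct.tmul_neg, sub_neg_eq_add]

end BaseChange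

variable {𝕜 𝔤 : Type*}

/-- The functional `p ↦ ∫₀¹ p`. -/
def unitIntervalIntegral (𝕜 : Type*) [Field 𝕜] : 𝕜[X] →ₗ[𝕜] 𝕜 :=
  Polynomial.lsum fun n => ((n : 𝕜) + 1)⁻¹ • LinearMap.id

theorem unitIntervalIntegral_derivative [Field 𝕜] [CharZero 𝕜] (p : 𝕜[X]) :
    unitIntervalIntegral 𝕜 (derivative p) = p.eval 1 - p.eval 0 := by
  induction p using Polynomial.induction_on' with
  | add p q hp hq => simp only [map_add, hp, hq, eval_add]; ring
  | monomial n c =>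
    rcases n with _ | n
    · simp
    · rw [derivative_monomial_succ]
      have hn : (n : 𝕜) + 1 ≠ 0 := Nat.cast_add_one_ne_zero n
      simp [unitIntervalIntegral, Polynomial.lsum_apply, Polynomial.sum_monomial_index,
        mul_comm c, inv_mul_cancel_left₀ hn]

theorem characterLieHom_one_eq_of_extendDerivation_eq [Field 𝕜] [CharZero 𝕜] [LieRing 𝔤]
    [LieAlgebra 𝕜 𝔤] {u w : 𝕜[X] ⊗[𝕜] 𝔤}
    (h : extendDerivation 𝔤 derivative' u = extendDerivation 𝔤 derivative' w)
    (h₀ : characterLieHom (aeval (0 : 𝕜)) u = characterLieHom (aeval (0 : 𝕜)) w) :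
    characterLieHom (aeval (1 : 𝕜)) u = characterLieHom (aeval (1 : 𝕜)) w := by
  let I : 𝕜[X] ⊗[𝕜] 𝔤 →ₗ[𝕜] 𝔤 :=
    (TensorProduct.lid 𝕜 𝔤).toLinearMap ∘ₗ LinearMap.rTensor 𝔤 (unitIntervalIntegral 𝕜)
  have hI (u : 𝕜[X] ⊗[𝕜] 𝔤) : I (extendDerivation 𝔤 derivative' u)
      = characterLieHom (aeval (1 : 𝕜)) u - characterLieHom (aeval (0 : 𝕜)) u := by
    induction u using TensorProduct.induction_on with
    | zero => simp
    | add x x' hx hx' => simp only [map_add, hx, hx']; abel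
    | tmul p x =>
      rw [characterLieHom_tmul, characterLieHom_tmul, ← sub_smul, coe_aeval_eq_eval,
        coe_aeval_eq_eval, ← unitIntervalIntegral_derivative]
      rfl
  rw [← sub_add_cancel (characterLieHom (aeval (1 : 𝕜)) u), ← hI, h, hI, h₀, sub_add_cancel]

variable [RCLike 𝕜] [LieRing 𝔤] [LieAlgebra 𝕜 𝔤] {N : ℕ}

theorem bch_assoc (V : LieFiltration 𝕜 𝔤 N) (x y z : 𝔤) :
    bch 𝕜 N (bch 𝕜 N x y) z = bch 𝕜 N x (bch 𝕜 N y z) := by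
  let _ : Algebra ℚ (Module.End 𝕜 ((𝕜[X] ⊗[𝕜] 𝔤) × 𝕜)) := Algebra.compHom _ (algebraMap ℚ 𝕜)
  set M := 2 * (N + 1) + 1 with hM
  have hNM : N ≤ M := by lia
  have h := characterLieHom_one_eq_of_extendDerivation_eq
    (derivation_bch_assoc (V.baseChange 𝕜[X]) (extendDerivation 𝔤 derivative') hM.ge
      (X ⊗ₜ x) (X ⊗ₜ y) (X ⊗ₜ z))
    (by simp [map_bch, characterLieHom_tmul, bch_of_lie_eq_zero (𝕜 := 𝕜) (show 1 ≤ M by lia)])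
  simpa only [map_bch, characterLieHom_tmul, aeval_X, one_smul, V.bch_eq_of_le hNM] using h

theorem bch_conj (V : LieFiltration 𝕜 𝔤 N) (x y : 𝔤) :
    bch 𝕜 N (bch 𝕜 N x y) (-x) = expAd 𝕜 (2 * (N + 1) + 1) x y := by
  let _ : Algebra ℚ (Module.End 𝕜 ((𝕜[X] ⊗[𝕜] 𝔤) × 𝕜)) := Algebra.compHom _ (algebraMap ℚ 𝕜)
  set M := 2 * (N + 1) + 1 with hM
  have hNM : N ≤ M := by lia
  have h := characterLieHom_one_eq_of_extendDerivation_eq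
    (derivation_bch_conj (V.baseChange 𝕜[X]) (extendDerivation 𝔤 derivative') hM.ge
      (X ⊗ₜ x) (X ⊗ₜ y))
    (by
      rw [map_expAd]
      simp [map_bch, characterLieHom_tmul, bch_of_lie_eq_zero (𝕜 := 𝕜) (show 1 ≤ M by lia), expAd])
  simpa only [map_bch, map_expAd, map_neg, characterLieHom_tmul, aeval_X, one_smul,
    V.bch_eq_of_le hNM] using h

/-- The group `(𝔤, ∗)`. -/
@[reducible]
def bchGroup (V : LieFiltration 𝕜 𝔤 N) (hN : 1 ≤ N) : Group 𝔤 where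
  mul x y := bch 𝕜 N x y
  mul_assoc := bch_assoc V
  one := 0
  one_mul x := (bch_of_lie_eq_zero hN (zero_lie x)).trans (zero_add x)
  mul_one x := (bch_of_lie_eq_zero hN (lie_zero x)).trans (add_zero x)
  inv x := -x
  inv_mul_cancel x := (bch_of_lie_eq_zero hN (by rw [neg_lie, lie_self, neg_zero])).trans
    (neg_add_cancel x)

end GroupLaw

/-! ### Polynomial curves -/

section PolynomialCurves

open Polynomial

section Field

variable {𝕜 : Type*} [Field 𝕜] {E F : Type*} [AddCommGroup E] [Module 𝕜 E] [AddCommGroup F]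
  [Module 𝕜 F]

/-- The polynomial curves of degree at most `D`. -/
def polyCurve (𝕜 : Type*) [Field 𝕜] (F : Type*) [AddCommGroup F] [Module 𝕜 F] (D : ℕ) :
    Submodule 𝕜 (𝕜 → F) :=
  Submodule.span 𝕜 {c | ∃ j ≤ D, ∃ w : F, c = fun t => t ^ j • w}

theorem pow_smul_mem_polyCurve {D j : ℕ} (hj : j ≤ D) (w : F) :
    (fun t : 𝕜 => t ^ j • w) ∈ polyCurve 𝕜 F D :=
  Submodule.subset_span ⟨j, hj, w, rfl⟩

theorem const_mem_polyCurve (D : ℕ) (w : F) : (fun _ : 𝕜 => w) ∈ polyCurve 𝕜 F D := by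
  simpa using pow_smul_mem_polyCurve (𝕜 := 𝕜) (Nat.zero_le D) w

theorem line_mem_polyCurve (x v : F) : (fun t : 𝕜 => x + t • v) ∈ polyCurve 𝕜 F 1 :=
  Submodule.add_mem _ (const_mem_polyCurve 1 x)
    (by simpa using pow_smul_mem_polyCurve (𝕜 := 𝕜) (le_refl 1) v)

theorem polyCurve_mono : Monotone (polyCurve 𝕜 F) := fun _ _ h =>
  Submodule.span_mono fun _ ⟨j, hj, w, hw⟩ => ⟨j, hj.trans h, w, hw⟩

theorem eval_smul_mem_polyCurve {D : ℕ} {P : 𝕜[X]} (hP : P.natDegree ≤ D) (w : F) :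
    (fun t : 𝕜 => P.eval t • w) ∈ polyCurve 𝕜 F D := by
  have h : (fun t : 𝕜 => P.eval t • w)
      = ∑ j ∈ Finset.range (D + 1), P.coeff j • fun t : 𝕜 => t ^ j • w := by
    ext t
    simp [eval_eq_sum_range' (Nat.lt_succ_of_le hP), Finset.sum_smul, smul_smul]
  rw [h]
  exact Submodule.sum_mem _ fun j hj => Submodule.smul_mem _ _
    (pow_smul_mem_polyCurve (Finset.mem_range_succ_iff.mp hj) w)

/-- A function all of whose restrictions to affine lines are polynomials of degree at most `D`. -/
def IsLinePoly (𝕜 : Type*) [Field 𝕜] {E F : Type*} [AddCommGroup E] [Module 𝕜 E] [AddCommGroup F]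
    [Module 𝕜 F] (D : ℕ) (f : E → F) : Prop :=
  ∀ x v : E, (fun t : 𝕜 => f (x + t • v)) ∈ polyCurve 𝕜 F D

theorem IsLinePoly.comp_linear {E' : Type*} [AddCommGroup E'] [Module 𝕜 E'] {D : ℕ} {f : E → F}
    (hf : IsLinePoly 𝕜 D f) (g : E' →ₗ[𝕜] E) (a : E) : IsLinePoly 𝕜 D fun x => f (a + g x) := by
  intro x v
  simpa [add_assoc] using hf (a + g x) (g v)

theorem isLinePoly_sum_smul {ι : Type*} {D : ℕ} (s : Finset ι) (a : ι → 𝕜) {f : ι → E → F}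
    (hf : ∀ i ∈ s, IsLinePoly 𝕜 D (f i)) : IsLinePoly 𝕜 D fun x => ∑ i ∈ s, a i • f i x := by
  intro x v
  convert Submodule.sum_mem _ fun i hi => Submodule.smul_mem _ (a i) (hf i hi x v) using 1
  ext t
  simp

/-- The Lagrange basis polynomials for the nodes `0, 1, …, D`. -/
noncomputable def lagrangeNat (𝕜 : Type*) [Field 𝕜] (D i : ℕ) : 𝕜[X] :=
  Lagrange.basis (Finset.range (D + 1)) (fun n : ℕ => (n : 𝕜)) i

/-- The weights `wᵢ` of the formula `(dP/dX)(0) = ∑ᵢ wᵢ P(i)`, exact in degree at most `D`. -/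
noncomputable def diffWeight (𝕜 : Type*) [Field 𝕜] (D i : ℕ) : 𝕜 :=
  (derivative (lagrangeNat 𝕜 D i)).eval 0

/-- The directional derivative at `x` of a function that is polynomial of degree at most `D` along
lines. -/
noncomputable def lineDer (𝕜 : Type*) [Field 𝕜] {E F : Type*} [AddCommGroup E] [Module 𝕜 E]
    [AddCommGroup F] [Module 𝕜 F] (D : ℕ) (f : E → F) (v x : E) : F :=
  ∑ i ∈ Finset.range (D + 1), diffWeight 𝕜 D i • f (x + (i : 𝕜) • v)

theorem IsLinePoly.isLinePoly_lineDer {D : ℕ} {f : E → F} (hf : IsLinePoly 𝕜 D f) (v : E) :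
    IsLinePoly 𝕜 D (lineDer 𝕜 D f v) :=
  isLinePoly_sum_smul _ _ fun i _ => by
    simpa [add_comm] using hf.comp_linear LinearMap.id ((i : 𝕜) • v)

variable [CharZero 𝕜]

theorem eq_sum_lagrangeNat {D : ℕ} {P : 𝕜[X]} (hP : P.natDegree ≤ D) :
    P = ∑ i ∈ Finset.range (D + 1), C (P.eval (i : 𝕜)) * lagrangeNat 𝕜 D i := by
  have h := Lagrange.eq_interpolate (s := Finset.range (D + 1)) (v := fun n : ℕ => (n : 𝕜))
    (f := P) Nat.cast_injective.injOn (by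
      rw [Finset.card_range]
      exact (degree_le_of_natDegree_le hP).trans_lt (by exact_mod_cast D.lt_succ_self))
  rwa [Lagrange.interpolate_apply] at h

theorem natDegree_lagrangeNat_le {D i : ℕ} (hi : i ∈ Finset.range (D + 1)) :
    (lagrangeNat 𝕜 D i).natDegree ≤ D := by
  refine natDegree_le_of_degree_le ?_
  rw [lagrangeNat, Lagrange.degree_basis Nat.cast_injective.injOn hi, Finset.card_range]
  simp

theorem eval_zero_lagrangeNat {D i : ℕ} (hi : i ∈ Finset.range (D + 1)) :
    (lagrangeNat 𝕜 D i).eval 0 = if i = 0 then 1 else 0 := by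
  split_ifs with h
  · subst h
    simpa [lagrangeNat] using Lagrange.eval_basis_self (s := Finset.range (D + 1))
      (v := fun n : ℕ => (n : 𝕜)) Nat.cast_injective.injOn hi
  · simpa [lagrangeNat] using Lagrange.eval_basis_of_ne (s := Finset.range (D + 1))
      (v := fun n : ℕ => (n : 𝕜)) (i := i) (j := 0) h (by simp)

theorem mem_polyCurve_iff {D : ℕ} {c : 𝕜 → F} : c ∈ polyCurve 𝕜 F D ↔
    ∀ t, c t = ∑ i ∈ Finset.range (D + 1), (lagrangeNat 𝕜 D i).eval t • c i := by
  refine ⟨fun hc => ?_, fun h => ?_⟩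
  · induction hc using Submodule.span_induction with
    | mem c hc =>
      obtain ⟨j, hj, w, rfl⟩ := hc
      intro t
      have hX := congrArg (eval t) (eq_sum_lagrangeNat (𝕜 := 𝕜) (D := D) (P := X ^ j)
        ((natDegree_X_pow_le j).trans hj))
      simp only [eval_pow, eval_X, eval_finsetSum, eval_mul, eval_C] at hX
      simp only [hX, Finset.sum_smul, smul_smul, mul_comm]
    | zero => simp
    | add c c' _ _ h h' => intro t; simp [h t, h' t, smul_add, Finset.sum_add_distrib]
    | smul a c _ h =>
      intro t
      simp only [Pi.smul_apply, h t, Finset.smul_sum, smul_comm a]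
  · have hc : c = ∑ i ∈ Finset.range (D + 1), fun t => (lagrangeNat 𝕜 D i).eval t • c i := by
      ext t; rw [h t, Finset.sum_apply]
    rw [hc]
    exact Submodule.sum_mem _ fun i hi => eval_smul_mem_polyCurve (natDegree_lagrangeNat_le hi) _

theorem map_mem_polyCurve {G : Type*} [AddCommGroup G] [Module 𝕜 G] (f : F →ₗ[𝕜] G) {D : ℕ}
    {c : 𝕜 → F} (hc : c ∈ polyCurve 𝕜 F D) : (fun t => f (c t)) ∈ polyCurve 𝕜 G D := by
  rw [mem_polyCurve_iff] at hc ⊢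
  exact fun t => by simp only [hc t, map_sum, map_smul]

theorem map₂_mem_polyCurve {G H : Type*} [AddCommGroup G] [Module 𝕜 G] [AddCommGroup H]
    [Module 𝕜 H] (f : F →ₗ[𝕜] G →ₗ[𝕜] H) {m n : ℕ} {c : 𝕜 → F} {d : 𝕜 → G}
    (hc : c ∈ polyCurve 𝕜 F m) (hd : d ∈ polyCurve 𝕜 G n) :
    (fun t => f (c t) (d t)) ∈ polyCurve 𝕜 H (m + n) := by
  rw [mem_polyCurve_iff] at hc hd
  have h : (fun t => f (c t) (d t)) = ∑ i ∈ Finset.range (m + 1), ∑ j ∈ Finset.range (n + 1),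
      fun t => (lagrangeNat 𝕜 m i * lagrangeNat 𝕜 n j).eval t • f (c i) (d j) := by
    ext t
    rw [hc t, hd t, LinearMap.map_sum₂]
    simp [Finset.sum_apply, smul_smul, mul_comm]
  rw [h]
  exact Submodule.sum_mem _ fun i hi => Submodule.sum_mem _ fun j hj =>
    eval_smul_mem_polyCurve (natDegree_mul_le_of_le (natDegree_lagrangeNat_le hi)
      (natDegree_lagrangeNat_le hj)) _

theorem IsLinePoly.apply_add_smul {D : ℕ} {f : E → F} (hf : IsLinePoly 𝕜 D f) (x v : E) (t : 𝕜) :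
    f (x + t • v)
      = ∑ i ∈ Finset.range (D + 1), (lagrangeNat 𝕜 D i).eval t • f (x + (i : 𝕜) • v) :=
  mem_polyCurve_iff.mp (hf x v) t

end Field

section Derivative

variable {𝕜 : Type*} [NontriviallyNormedField 𝕜] [CharZero 𝕜]
  {E F : Type*} [AddCommGroup E] [Module 𝕜 E] [AddCommGroup F] [Module 𝕜 F]

theorem tendsto_slope_polyCurve [TopologicalSpace F] [ContinuousAdd F]
    (hF : ∀ a : F, Continuous fun t : 𝕜 => t • a) {D : ℕ} {c : 𝕜 → F}
    (hc : c ∈ polyCurve 𝕜 F D) :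
    Tendsto (fun t : 𝕜 => t⁻¹ • (c t - c 0)) (𝓝[≠] 0)
      (𝓝 (∑ i ∈ Finset.range (D + 1), diffWeight 𝕜 D i • c i)) := by
  rw [mem_polyCurve_iff] at hc
  have hslope (t : 𝕜) : t⁻¹ • (c t - c 0) = ∑ i ∈ Finset.range (D + 1),
      slope (fun s => (lagrangeNat 𝕜 D i).eval s) 0 t • c i := by
    rw [hc t, hc 0, ← Finset.sum_sub_distrib, Finset.smul_sum]
    refine Finset.sum_congr rfl fun i _ => ?_
    rw [← sub_smul, smul_smul, slope_def_module, sub_zero, smul_eq_mul]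
  simp only [hslope]
  exact tendsto_finsetSum _ fun i _ => ((hF (c i)).tendsto _).comp
    (hasDerivAt_iff_tendsto_slope.mp ((lagrangeNat 𝕜 D i).hasDerivAt 0))

theorem hasDerivAt_polyCurve {D : ℕ} {c : 𝕜 → 𝕜} (hc : c ∈ polyCurve 𝕜 𝕜 D) :
    HasDerivAt c (∑ i ∈ Finset.range (D + 1), diffWeight 𝕜 D i • c i) 0 := by
  rw [hasDerivAt_iff_tendsto_slope]
  refine (tendsto_slope_polyCurve (fun a => continuous_id.smul continuous_const) hc).congr ?_
  exact fun t => by rw [slope_def_module, sub_zero]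

theorem IsLinePoly.hasDerivAt {D : ℕ} {f : E → 𝕜} (hf : IsLinePoly 𝕜 D f) (x v : E) :
    HasDerivAt (fun t : 𝕜 => f (x + t • v)) (lineDer 𝕜 D f v x) 0 :=
  hasDerivAt_polyCurve (hf x v)

theorem IsLinePoly.lineDer_smul {D : ℕ} {f : E → 𝕜} (hf : IsLinePoly 𝕜 D f) (a : 𝕜) (v x : E) :
    lineDer 𝕜 D f (a • v) x = a • lineDer 𝕜 D f v x := by
  have hv : HasDerivAt (fun t : 𝕜 => f (x + t • v)) (lineDer 𝕜 D f v x) (0 * a) := by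
    rw [zero_mul]; exact hf.hasDerivAt x v
  have hav : HasDerivAt (fun t : 𝕜 => f (x + (t * a) • v)) (lineDer 𝕜 D f v x * a) 0 :=
    hv.comp (h := fun t => t * a) (0 : 𝕜) (by simpa using (hasDerivAt_id (0 : 𝕜)).mul_const a)
  simp only [mul_smul] at hav
  rw [(hf.hasDerivAt x (a • v)).unique hav, smul_eq_mul, mul_comm]

theorem IsLinePoly.lineDer_add {D : ℕ} {f : E → 𝕜} (hf : IsLinePoly 𝕜 D f) (u v x : E) :
    lineDer 𝕜 D f (u + v) x = lineDer 𝕜 D f u x + lineDer 𝕜 D f v x := by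
  have huv := hf.hasDerivAt x (u + v)
  have hexpand : (fun t : 𝕜 => f (x + t • (u + v))) = fun t : 𝕜 => ∑ i ∈ Finset.range (D + 1),
      (lagrangeNat 𝕜 D i).eval t * f ((x + (i : 𝕜) • v) + t • u) := by
    ext t
    rw [smul_add, ← add_assoc, hf.apply_add_smul]
    simp only [smul_eq_mul, add_right_comm]
  rw [hexpand] at huv
  rw [huv.unique (HasDerivAt.fun_sum fun i _ =>
    ((lagrangeNat 𝕜 D i).hasDerivAt 0).mul (hf.hasDerivAt _ _)), Finset.sum_add_distrib, add_comm]
  congr 1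
  · rw [Finset.sum_eq_single_of_mem 0 (by simp) fun i hi h0 => by
      rw [eval_zero_lagrangeNat hi, if_neg h0, zero_mul]]
    simp [eval_zero_lagrangeNat]
  · simp [lineDer, diffWeight]

end Derivative

theorem IsLinePoly.isCk {𝕜 : Type*} [RCLike 𝕜] {F : Type*} [AddCommGroup F] [Module 𝕜 F]
    [TopologicalSpace F] [ContinuousAdd F] [ContinuousConstSMul 𝕜 F]
    (hF : ∀ a : F, Continuous fun t : 𝕜 => t • a) {D : ℕ} (k : ℕ) {E : Type u} [AddCommGroup E]
    [Module 𝕜 E] [TopologicalSpace E] [ContinuousAdd E] [ContinuousConstSMul 𝕜 E] {f : E → F}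
    (hc : Continuous f) (hf : IsLinePoly 𝕜 D f) : IsCk 𝕜 k E f := by
  induction k generalizing E with
  | zero => exact hc
  | succ k ih =>
    refine ⟨hc, fun p => lineDer 𝕜 D f p.2 p.1, fun x v => ?_, ih ?_ ?_⟩
    · simpa only [zero_smul, add_zero, lineDer] using tendsto_slope_polyCurve hF (hf x v)
    · exact continuous_finsetSum _ fun i _ => Continuous.const_smul
        (hc.comp (continuous_fst.add (continuous_snd.const_smul _))) _
    · refine isLinePoly_sum_smul _ _ fun i _ => ?_
      simpa using hf.comp_linear (LinearMap.fst 𝕜 E E + (i : 𝕜) • LinearMap.snd 𝕜 E E) 0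

end PolynomialCurves

section ContinuousPolynomials

open Polynomial

section Field

variable {𝕜 : Type*} [Field 𝕜] {E : Type*} [AddCommGroup E] [Module 𝕜 E]

/-- The iterated directional derivative in the directions `v 0, …, v (j - 1)`. -/
noncomputable def iterLineDer (𝕜 : Type*) [Field 𝕜] {E : Type*} [AddCommGroup E] [Module 𝕜 E]
    (D : ℕ) (f : E → 𝕜) : (j : ℕ) → (Fin j → E) → E → 𝕜
  | 0, _ => f
  | j + 1, v => lineDer 𝕜 D (iterLineDer 𝕜 D f j (Fin.tail v)) (v 0)

theorem IsLinePoly.isLinePoly_iterLineDer {D : ℕ} {f : E → 𝕜} (hf : IsLinePoly 𝕜 D f) (j : ℕ)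
    (v : Fin j → E) : IsLinePoly 𝕜 D (iterLineDer 𝕜 D f j v) := by
  induction j with
  | zero => exact hf
  | succ j ih => exact (ih _).isLinePoly_lineDer _

theorem exists_polynomial_of_mem_polyCurve [CharZero 𝕜] {D : ℕ} {c : 𝕜 → 𝕜}
    (hc : c ∈ polyCurve 𝕜 𝕜 D) : ∃ P : 𝕜[X], P.natDegree ≤ D ∧ ∀ t, c t = P.eval t := by
  refine ⟨∑ i ∈ Finset.range (D + 1), C (c i) * lagrangeNat 𝕜 D i, ?_, fun t => ?_⟩
  · exact natDegree_sum_le_of_forall_le _ _ fun i hi =>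
      (natDegree_C_mul_le _ _).trans (natDegree_lagrangeNat_le hi)
  · simp only [mem_polyCurve_iff.mp hc t, eval_finsetSum, eval_mul, eval_C, smul_eq_mul, mul_comm]

theorem eval_one_eq_sum_iterate_derivative [CharZero 𝕜] {D : ℕ} {P : 𝕜[X]}
    (hP : P.natDegree ≤ D) : P.eval 1 = ∑ j ∈ Finset.range (D + 1),
      (j.factorial : 𝕜)⁻¹ * (derivative^[j] P).eval 0 := by
  rw [eval_eq_sum_range' (Nat.lt_succ_of_le hP)]
  refine Finset.sum_congr rfl fun j _ => ?_
  rw [← coeff_zero_eq_eval_zero, coeff_iterate_derivative, zero_add, Nat.descFactorial_self,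
    one_pow, mul_one, nsmul_eq_mul, inv_mul_cancel_left₀]
  exact_mod_cast j.factorial_ne_zero

end Field

section NormedField

variable {𝕜 : Type*} [NontriviallyNormedField 𝕜] {E : Type*} [AddCommGroup E] [Module 𝕜 E]

theorem continuous_iterLineDer [TopologicalSpace E] [ContinuousAdd E] [ContinuousConstSMul 𝕜 E]
    {f : E → 𝕜} (hf : Continuous f) (D j : ℕ) :
    Continuous fun p : (Fin j → E) × E => iterLineDer 𝕜 D f j p.1 p.2 := by
  induction j with
  | zero => exact hf.comp continuous_snd
  | succ j ih =>
    have hshift (i : ℕ) : Continuous fun p : (Fin (j + 1) → E) × E =>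
        ((Fin.tail p.1, p.2 + (i : 𝕜) • p.1 0) : (Fin j → E) × E) :=
      Continuous.prodMk (continuous_pi fun k => (continuous_apply k.succ).comp continuous_fst)
        (continuous_snd.add (((continuous_apply 0).comp continuous_fst).const_smul _))
    simp only [iterLineDer, lineDer]
    exact continuous_finsetSum _ fun i _ => (ih.comp (hshift i)).const_smul (diffWeight 𝕜 D i)

variable [CharZero 𝕜] {D : ℕ} {f : E → 𝕜}

theorem IsLinePoly.iterLineDer_update_add (hf : IsLinePoly 𝕜 D f) (j : ℕ)
    (v : Fin j → E) (i : Fin j) (a b x : E) :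
    iterLineDer 𝕜 D f j (Function.update v i (a + b)) x
      = iterLineDer 𝕜 D f j (Function.update v i a) x
        + iterLineDer 𝕜 D f j (Function.update v i b) x := by
  induction j generalizing x with
  | zero => exact i.elim0
  | succ j ih =>
    refine Fin.cases ?_ (fun i => ?_) i
    · simp only [iterLineDer, Fin.tail_update_zero, Function.update_self]
      exact (hf.isLinePoly_iterLineDer _ _).lineDer_add _ _ _
    · simp only [iterLineDer, Fin.tail_update_succ, lineDer, ih, smul_add,
        Function.update_of_ne (Fin.succ_ne_zero i).symm, Finset.sum_add_distrib]

theorem IsLinePoly.iterLineDer_update_smul (hf : IsLinePoly 𝕜 D f) (j : ℕ)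
    (v : Fin j → E) (i : Fin j) (c : 𝕜) (a x : E) :
    iterLineDer 𝕜 D f j (Function.update v i (c • a)) x
      = c • iterLineDer 𝕜 D f j (Function.update v i a) x := by
  induction j generalizing x with
  | zero => exact i.elim0
  | succ j ih =>
    refine Fin.cases ?_ (fun i => ?_) i
    · simp only [iterLineDer, Fin.tail_update_zero, Function.update_self]
      exact (hf.isLinePoly_iterLineDer _ _).lineDer_smul _ _ _
    · simp only [iterLineDer, Fin.tail_update_succ, lineDer, ih,
        Function.update_of_ne (Fin.succ_ne_zero i).symm, Finset.smul_sum, smul_comm c]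

/-- The iterated directional derivative at `x`, as a continuous multilinear form. -/
noncomputable def iterLineDerForm [TopologicalSpace E] [ContinuousAdd E] [ContinuousConstSMul 𝕜 E]
    (hf : IsLinePoly 𝕜 D f) (hc : Continuous f) (j : ℕ) (x : E) :
    ContinuousMultilinearMap 𝕜 (fun _ : Fin j => E) 𝕜 where
  toFun v := iterLineDer 𝕜 D f j v x
  map_update_add' {inst} v i a b := by
    rw [Subsingleton.elim inst (instDecidableEqFin j)]
    exact hf.iterLineDer_update_add j v i a b x
  map_update_smul' {inst} v i c a := by
    rw [Subsingleton.elim inst (instDecidableEqFin j)]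
    exact hf.iterLineDer_update_smul j v i c a x
  cont := (continuous_iterLineDer hc D j).comp (continuous_id.prodMk continuous_const)

theorem IsLinePoly.lineDer_eq_eval_derivative (hf : IsLinePoly 𝕜 D f) {y : E} {P : 𝕜[X]}
    (hP : ∀ t : 𝕜, f (t • y) = P.eval t) (t : 𝕜) :
    lineDer 𝕜 D f y (t • y) = (derivative P).eval t := by
  have hfy := hf.hasDerivAt (t • y) y
  simp only [← add_smul, hP] at hfy
  refine hfy.unique (HasDerivAt.comp_const_add (f := fun s => P.eval s) t 0 ?_)
  rw [add_zero]
  exact P.hasDerivAt t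

theorem IsLinePoly.iterLineDer_eq_eval_iterate_derivative (hf : IsLinePoly 𝕜 D f) {y : E}
    {P : 𝕜[X]} (hP : ∀ t : 𝕜, f (t • y) = P.eval t) (j : ℕ) (t : 𝕜) :
    iterLineDer 𝕜 D f j (fun _ => y) (t • y) = (derivative^[j] P).eval t := by
  induction j generalizing t with
  | zero => exact hP t
  | succ j ih =>
    rw [Function.iterate_succ_apply']
    exact (hf.isLinePoly_iterLineDer j _).lineDer_eq_eval_derivative ih t

end NormedField

theorem mem_contPoly_of_isLinePoly {𝕜 : Type*} [RCLike 𝕜] {E : Type*} [AddCommGroup E]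
    [Module 𝕜 E] [TopologicalSpace E] [ContinuousAdd E] [ContinuousConstSMul 𝕜 E] {D : ℕ}
    {φ : ContFun 𝕜 E} (hφ : IsLinePoly 𝕜 D φ) : φ ∈ ContPoly 𝕜 E D := by
  refine ⟨fun j => (j.factorial : 𝕜)⁻¹ • iterLineDerForm hφ φ.continuous j 0, fun y => ?_⟩
  obtain ⟨P, hPD, hP⟩ := exists_polynomial_of_mem_polyCurve (hφ 0 y)
  simp only [zero_add] at hP
  calc φ y = P.eval 1 := by rw [← hP 1, one_smul]
    _ = ∑ j ∈ Finset.range (D + 1), (j.factorial : 𝕜)⁻¹ * (derivative^[j] P).eval 0 :=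
      eval_one_eq_sum_iterate_derivative hPD
    _ = _ := Finset.sum_congr rfl fun j _ => by
      rw [← hφ.iterLineDer_eq_eval_iterate_derivative hP j 0, zero_smul]
      rfl

end ContinuousPolynomials

section BCHAnalysis

variable {𝕜 𝔤 : Type*} [RCLike 𝕜] [LieRing 𝔤] [LieAlgebra 𝕜 𝔤]

section PolynomialCurves

variable {m n : ℕ} {c d : 𝕜 → 𝔤}

theorem ad_pow_mem_polyCurve (hc : c ∈ polyCurve 𝕜 𝔤 m) (hd : d ∈ polyCurve 𝕜 𝔤 n) (k : ℕ) :
    (fun t => (LieAlgebra.ad 𝕜 𝔤 (c t) ^ k) (d t)) ∈ polyCurve 𝕜 𝔤 (k * m + n) := by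
  induction k with
  | zero => simpa using hd
  | succ k ih =>
    rw [show (k + 1) * m + n = m + (k * m + n) by ring]
    simpa only [pow_succ', Module.End.mul_apply] using!
      map₂_mem_polyCurve (LieAlgebra.ad 𝕜 𝔤 : 𝔤 →ₗ[𝕜] Module.End 𝕜 𝔤) hc ih

theorem adWord_mem_polyCurve {z : 𝕜 → 𝔤} (hc : c ∈ polyCurve 𝕜 𝔤 m)
    (hd : d ∈ polyCurve 𝕜 𝔤 m) (hz : z ∈ polyCurve 𝕜 𝔤 n) (l : List (ℕ × ℕ)) :
    (fun t => adWord 𝕜 (c t) (d t) l (z t))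
      ∈ polyCurve 𝕜 𝔤 ((l.map fun q => q.1 + q.2).sum * m + n) := by
  induction l with
  | nil => simpa [adWord] using hz
  | cons q l ih =>
    simp only [adWord, List.map_cons, List.prod_cons, Module.End.mul_apply, List.sum_cons] at ih ⊢
    convert ad_pow_mem_polyCurve hc (ad_pow_mem_polyCurve hd ih q.2) q.1 using 2
    ring

theorem LieFiltration.bch_mem_polyCurve {N : ℕ} (V : LieFiltration 𝕜 𝔤 N) (hN : 1 ≤ N)
    (hc : c ∈ polyCurve 𝕜 𝔤 m) (hd : d ∈ polyCurve 𝕜 𝔤 m) :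
    (fun t => bch 𝕜 N (c t) (d t)) ∈ polyCurve 𝕜 𝔤 (N * m) := by
  have hsum : (fun t => bch 𝕜 N (c t) (d t)) = c + ∑ k ∈ Finset.range N,
      ∑ p ∈ Fintype.piFinset (fun _ : Fin k => bchExponents N), ∑ r ∈ Finset.range N,
        bchCoeff 𝕜 p r • fun t => adWord 𝕜 (c t) (d t) (List.ofFn p)
          ((LieAlgebra.ad 𝕜 𝔤 (c t) ^ r) (d t)) := by
    ext t
    simp only [bch_eq_sum, Pi.add_apply, Finset.sum_apply, Pi.smul_apply]
  rw [hsum]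
  refine Submodule.add_mem _ (polyCurve_mono (Nat.le_mul_of_pos_left m hN) hc)
    (Submodule.sum_mem _ fun k _ => Submodule.sum_mem _ fun p _ => Submodule.sum_mem _ fun r _ =>
      Submodule.smul_mem _ _ ?_)
  by_cases h : N ≤ r + ∑ i, ((p i).1 + (p i).2)
  · simp only [V.adWord_ofFn_apply_eq_zero _ _ _ h]
    exact const_mem_polyCurve _ 0
  · refine polyCurve_mono ?_ (adWord_mem_polyCurve hc hd (ad_pow_mem_polyCurve hc hd r) _)
    rw [List.map_ofFn, List.sum_ofFn]
    calc _ = (r + ∑ i, ((p i).1 + (p i).2) + 1) * m := by simp only [Function.comp_apply]; ring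
      _ ≤ N * m := Nat.mul_le_mul_right _ (by lia)

end PolynomialCurves

section Pointwise

variable {ι : Type*} (W : Submodule 𝕜 (ι → 𝔤))
  (hW : ∀ f g : ι → 𝔤, f ∈ W → g ∈ W → (fun i => ⁅f i, g i⁆) ∈ W) {f g : ι → 𝔤}

include hW

theorem pointwise_ad_pow_mem (hf : f ∈ W) (hg : g ∈ W) (n : ℕ) :
    (fun i => (LieAlgebra.ad 𝕜 𝔤 (f i) ^ n) (g i)) ∈ W := by
  induction n with
  | zero => simpa using hg
  | succ n ih =>
    simpa only [pow_succ', Module.End.mul_apply, LieAlgebra.ad_apply] using hW _ _ hf ih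

theorem pointwise_adWord_mem {z : ι → 𝔤} (hf : f ∈ W) (hg : g ∈ W) (hz : z ∈ W)
    (l : List (ℕ × ℕ)) : (fun i => adWord 𝕜 (f i) (g i) l (z i)) ∈ W := by
  induction l with
  | nil => simpa [adWord] using hz
  | cons q l ih =>
    simp only [adWord, List.map_cons, List.prod_cons, Module.End.mul_apply] at ih ⊢
    exact pointwise_ad_pow_mem W hW hf (pointwise_ad_pow_mem W hW hg ih _) _

theorem pointwise_bch_mem (hf : f ∈ W) (hg : g ∈ W) (N : ℕ) :
    (fun i => bch 𝕜 N (f i) (g i)) ∈ W := by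
  have hsum : (fun i => bch 𝕜 N (f i) (g i)) = f + ∑ k ∈ Finset.range N,
      ∑ p ∈ Fintype.piFinset (fun _ : Fin k => bchExponents N), ∑ r ∈ Finset.range N,
        bchCoeff 𝕜 p r • fun i => adWord 𝕜 (f i) (g i) (List.ofFn p)
          ((LieAlgebra.ad 𝕜 𝔤 (f i) ^ r) (g i)) := by
    ext i
    simp only [bch_eq_sum, Pi.add_apply, Finset.sum_apply, Pi.smul_apply]
  rw [hsum]
  exact Submodule.add_mem _ hf (Submodule.sum_mem _ fun k _ => Submodule.sum_mem _ fun p _ =>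
    Submodule.sum_mem _ fun r _ => Submodule.smul_mem _ _
      (pointwise_adWord_mem W hW hf hg (pointwise_ad_pow_mem W hW hf hg r) _))

end Pointwise

variable [TopologicalSpace 𝔤] [ContinuousLieBracket 𝔤]

theorem continuous_bch [ContinuousAdd 𝔤] [ContinuousConstSMul 𝕜 𝔤] {Y : Type*}
    [TopologicalSpace Y] {f g : Y → 𝔤} (hf : Continuous f) (hg : Continuous g) (N : ℕ) :
    Continuous fun y => bch 𝕜 N (f y) (g y) :=
  let W : Submodule 𝕜 (Y → 𝔤) :=
    { carrier := {f | Continuous f}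
      add_mem' := Continuous.add
      zero_mem' := continuous_zero
      smul_mem' := fun a _ h => h.const_smul a }
  pointwise_bch_mem W (fun _ _ hf hg =>
    ContinuousLieBracket.continuous_bracket.comp (hf.prodMk hg)) hf hg N

variable [ContinuousSMul 𝕜 𝔤] {ι : Type*} {f g : ι → 𝔤}

theorem isVonNBounded_range_lie (hf : Bornology.IsVonNBounded 𝕜 (Set.range f))
    (hg : Bornology.IsVonNBounded 𝕜 (Set.range g)) :
    Bornology.IsVonNBounded 𝕜 (Set.range fun i => ⁅f i, g i⁆) := by
  obtain ⟨ε, hε⟩ := Filter.exists_seq_tendsto (𝓝[≠] (0 : 𝕜))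
  have hε2 : Tendsto (fun n => ε n * ε n) atTop (𝓝[≠] 0) := by
    rw [tendsto_nhdsWithin_iff] at hε ⊢
    exact ⟨by simpa using hε.1.mul hε.1, hε.2.mono fun n hn => mul_ne_zero hn hn⟩
  rw [Bornology.isVonNBounded_iff_smul_tendsto_zero hε] at hf hg
  rw [Bornology.isVonNBounded_iff_smul_tendsto_zero hε2]
  intro z hz
  choose s hs using hz
  have h := ((ContinuousLieBracket.continuous_bracket (𝔤 := 𝔤)).tendsto (0, 0)).comp
    ((hf (fun n => f (s n)) fun n => ⟨s n, rfl⟩).prodMk_nhds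
      (hg (fun n => g (s n)) fun n => ⟨s n, rfl⟩))
  simpa only [Function.comp_def, Pi.smul_def', lie_smul, smul_lie, smul_smul, lie_zero, hs] using h

theorem isVonNBounded_range_bch [IsTopologicalAddGroup 𝔤]
    (hf : Bornology.IsVonNBounded 𝕜 (Set.range f)) (hg : Bornology.IsVonNBounded 𝕜 (Set.range g))
    (N : ℕ) : Bornology.IsVonNBounded 𝕜 (Set.range fun i => bch 𝕜 N (f i) (g i)) :=
  let W : Submodule 𝕜 (ι → 𝔤) :=
    { carrier := {f | Bornology.IsVonNBounded 𝕜 (Set.range f)}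
      add_mem' := fun {f g} hf hg => (hf.add hg).subset <| by
        rintro _ ⟨i, rfl⟩
        exact Set.add_mem_add ⟨i, rfl⟩ ⟨i, rfl⟩
      zero_mem' := (Bornology.isVonNBounded_singleton 0).subset (by rintro _ ⟨i, rfl⟩; rfl)
      smul_mem' := fun a f hf => (hf.image (a • ContinuousLinearMap.id 𝕜 𝔤)).subset <| by
        rintro _ ⟨i, rfl⟩
        exact ⟨f i, ⟨i, rfl⟩, rfl⟩ }
  pointwise_bch_mem W (fun _ _ => isVonNBounded_range_lie) hf hg N

end BCHAnalysis

/-! ### Uniform convergence on bounded sets -/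

section UniformConvergenceOnBoundedSets

open scoped Pointwise

theorem IsLinePoly.apply_add_smul_eq_sum_div {𝕜 : Type*} [Field 𝕜] [CharZero 𝕜] {E F : Type*}
    [AddCommGroup E] [Module 𝕜 E] [AddCommGroup F] [Module 𝕜 F] {D : ℕ} {f : E → F}
    (hf : IsLinePoly 𝕜 D f) (x v : E) (t : 𝕜) :
    f (x + t • v) = ∑ i ∈ Finset.range (D + 1),
      (lagrangeNat 𝕜 D i).eval (t * (D + 1)) • f (x + ((i : 𝕜) / (D + 1)) • v) := by
  have hD : (D : 𝕜) + 1 ≠ 0 := D.cast_add_one_ne_zero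
  simpa [smul_smul, hD, div_eq_mul_inv] using
    hf.apply_add_smul x (((D : 𝕜) + 1)⁻¹ • v) (t * (D + 1))

variable {𝕜 : Type*} [RCLike 𝕜] {E : Type*} [AddCommGroup E] [Module 𝕜 E]

theorem natCast_div_smul_mem_of_balanced {U : Set E} (hU : Balanced 𝕜 U) {u : E} (hu : u ∈ U)
    {D i : ℕ} (hi : i ∈ Finset.range (D + 1)) : ((i : 𝕜) / (D + 1)) • u ∈ U := by
  refine hU.smul_mem ?_ hu
  have hD : ‖(D : 𝕜) + 1‖ = D + 1 := by exact_mod_cast RCLike.norm_natCast (K := 𝕜) (D + 1)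
  rw [norm_div, hD, RCLike.norm_natCast]
  exact div_le_one_of_le₀ (by exact_mod_cast (Finset.mem_range.mp hi).le) (by positivity)

section Bounds

variable {F : Type*} [SeminormedAddCommGroup F] [NormedSpace 𝕜 F] {D : ℕ} {f : E → F} {U : Set E}
  {x u : E} {K : ℝ}

theorem IsLinePoly.norm_apply_add_smul_le (hf : IsLinePoly 𝕜 D f) (hU : Balanced 𝕜 U)
    (hK : ∀ u ∈ U, ‖f (x + u)‖ ≤ K) (hu : u ∈ U) (t : 𝕜) :
    ‖f (x + t • u)‖
      ≤ ∑ i ∈ Finset.range (D + 1), ‖(lagrangeNat 𝕜 D i).eval (t * (D + 1))‖ * K := by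
  rw [hf.apply_add_smul_eq_sum_div]
  refine norm_sum_le_of_le _ fun i hi => ?_
  rw [norm_smul]
  exact mul_le_mul_of_nonneg_left (hK _ (natCast_div_smul_mem_of_balanced hU hu hi))
    (norm_nonneg _)

theorem IsLinePoly.norm_apply_add_smul_sub_le (hf : IsLinePoly 𝕜 D f) (hU : Balanced 𝕜 U)
    (hK : ∀ u ∈ U, ‖f (x + u)‖ ≤ K) (hu : u ∈ U) (t : 𝕜) :
    ‖f (x + t • u) - f x‖ ≤ ∑ i ∈ Finset.range (D + 1),
      ‖(lagrangeNat 𝕜 D i).eval (t * (D + 1)) - (lagrangeNat 𝕜 D i).eval 0‖ * K := by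
  have h₀ := hf.apply_add_smul_eq_sum_div x u 0
  simp only [zero_smul, add_zero, zero_mul] at h₀
  rw [hf.apply_add_smul_eq_sum_div, h₀, ← Finset.sum_sub_distrib]
  refine norm_sum_le_of_le _ fun i hi => ?_
  rw [← sub_smul, norm_smul]
  exact mul_le_mul_of_nonneg_left (hK _ (natCast_div_smul_mem_of_balanced hU hu hi))
    (norm_nonneg _)

end Bounds

theorem IsLinePoly.exists_nhds_norm_le {Y : Type*} [AddCommGroup Y] [Module 𝕜 Y]
    [TopologicalSpace Y] [ContinuousAdd Y] [TopologicalSpace E] [ContinuousSMul 𝕜 E]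
    {F : Type*} [SeminormedAddCommGroup F] [NormedSpace 𝕜 F] {D : ℕ} {h : Y × E → F}
    (hc : Continuous h) (hp : IsLinePoly 𝕜 D h) (x₀ : Y) {B : Set E}
    (hB : Bornology.IsVonNBounded 𝕜 B) :
    ∃ U ∈ 𝓝 (0 : Y), ∃ K : ℝ, ∀ u ∈ U, ∀ y ∈ B, ‖h (x₀ + u, y)‖ ≤ K := by
  have hcont : Continuous fun p : Y × E => ‖h (x₀ + p.1, p.2)‖ :=
    (hc.comp ((continuous_const.add continuous_fst).prodMk continuous_snd)).norm
  have hev := (hcont.tendsto (0, 0)).eventually_lt_const (lt_add_one _)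
  rw [nhds_prod_eq] at hev
  obtain ⟨pU, hU, pV, hV, hUV⟩ := eventually_prod_iff.mp hev
  obtain ⟨r, hr, hBr⟩ := (hB (balancedCore_mem_nhds_zero (𝕜 := 𝕜) hV)).exists_pos
  refine ⟨{u | pU u}, hU, ∑ i ∈ Finset.range (D + 1),
    ‖(lagrangeNat 𝕜 D i).eval ((r : 𝕜) * (D + 1))‖ * (‖h (x₀ + 0, 0)‖ + 1), fun u hu y hy => ?_⟩
  obtain ⟨v, hv, rfl⟩ := hBr (r : 𝕜) (by simp [abs_of_pos hr]) hy
  have hslice : IsLinePoly 𝕜 D fun v : E => h (x₀ + u, v) := by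
    simpa using hp.comp_linear (LinearMap.inr 𝕜 Y E) (x₀ + u, 0)
  have hK : ∀ v ∈ balancedCore 𝕜 {v | pV v}, ‖h (x₀ + u, 0 + v)‖ ≤ ‖h (x₀ + 0, 0)‖ + 1 :=
    fun v hv => by
      rw [zero_add]
      exact (hUV hu (balancedCore_subset {v | pV v} hv)).le
  simpa only [zero_add] using hslice.norm_apply_add_smul_le (balancedCore_balanced _) hK hv (r : 𝕜)

namespace ContFun

theorem ext {X : Type*} [TopologicalSpace X] {φ ψ : ContFun 𝕜 X} (h : ∀ y, φ y = ψ y) : φ = ψ :=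
  DFunLike.ext (F := ContFun 𝕜 X) φ ψ h

variable [TopologicalSpace E]

theorem tendsto_iff {ι : Type*} {l : Filter ι} {f : ι → ContFun 𝕜 E} {φ : ContFun 𝕜 E} :
    Tendsto f l (𝓝 φ) ↔ ∀ B : Set E, Bornology.IsVonNBounded 𝕜 B →
      TendstoUniformlyOn (fun i y => f i y) φ l B := by
  rw [(Topology.IsInducing.mk rfl : Topology.IsInducing (toUniformOn 𝕜 E)).tendsto_nhds_iff,
    UniformOnFun.tendsto_iff_tendstoUniformlyOn]
  rfl

theorem continuous_eval [ContinuousSMul 𝕜 E] (y : E) : Continuous fun φ : ContFun 𝕜 E => φ y :=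
  continuous_iff_continuousAt.mpr fun _ =>
    (tendsto_iff.mp tendsto_id {y} (Bornology.isVonNBounded_singleton y)).tendsto_at rfl

theorem continuous_of_isLinePoly [ContinuousSMul 𝕜 E] {Y : Type*} [AddCommGroup Y]
    [Module 𝕜 Y] [TopologicalSpace Y] [IsTopologicalAddGroup Y] [ContinuousSMul 𝕜 Y] {D : ℕ}
    {h : Y → ContFun 𝕜 E} (hc : Continuous fun p : Y × E => h p.1 p.2)
    (hp : IsLinePoly 𝕜 D fun p : Y × E => h p.1 p.2) : Continuous h := by
  refine continuous_iff_continuousAt.mpr fun x₀ => tendsto_iff.mpr fun B hB => ?_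
  obtain ⟨U₀, hU₀, K, hK⟩ := hp.exists_nhds_norm_le hc x₀ hB
  set U := balancedCore 𝕜 U₀
  let weight : 𝕜 → ℝ := fun t => ∑ i ∈ Finset.range (D + 1),
    ‖(lagrangeNat 𝕜 D i).eval (t * (D + 1)) - (lagrangeNat 𝕜 D i).eval 0‖ * K
  have hweight : Continuous weight :=
    continuous_finsetSum _ fun i _ => (((lagrangeNat 𝕜 D i).continuous.comp
      (continuous_id.mul continuous_const)).sub continuous_const).norm.mul continuous_const
  rw [Metric.tendstoUniformlyOn_iff]
  intro ε hε
  obtain ⟨τ, hτε, hτ⟩ : ∃ τ : 𝕜, weight τ < ε ∧ τ ≠ 0 :=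
    ((((hweight.tendsto 0).eventually_lt_const (by simpa [weight] using hε)).filter_mono
      nhdsWithin_le_nhds).and (eventually_mem_nhdsWithin (s := {0}ᶜ))).exists
  have hnhds : ∀ᶠ x in 𝓝 x₀, x - x₀ ∈ τ • U := by
    refine (continuous_id.sub continuous_const).tendsto' x₀ 0 (sub_self x₀) ?_
    simpa using (smul_mem_nhds_smul_iff₀ hτ).mpr (balancedCore_mem_nhds_zero hU₀)
  filter_upwards [hnhds] with x ⟨u, hu, hux⟩ y hy
  obtain rfl : x₀ + τ • u = x := by rw [show τ • u = x - x₀ from hux]; abel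
  have hslice : IsLinePoly 𝕜 D fun x : Y => h x y := by
    simpa using hp.comp_linear (LinearMap.inl 𝕜 Y E) (0, y)
  rw [dist_comm, dist_eq_norm]
  exact (hslice.norm_apply_add_smul_sub_le (balancedCore_balanced _)
    (fun u hu => hK u (balancedCore_subset _ hu) y hy) hu τ).trans_lt hτε

end ContFun

end UniformConvergenceOnBoundedSets

/-! ### The closed span `F_G` -/

section ClosedSpan

theorem separatingDual_of_locallyConvexSpace (𝕜 : Type*) [RCLike 𝕜] (E : Type*) [AddCommGroup E]
    [Module 𝕜 E] [TopologicalSpace E] [IsTopologicalAddGroup E] [ContinuousSMul 𝕜 E] [Module ℝ E]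
    [IsScalarTower ℝ 𝕜 E] [LocallyConvexSpace ℝ E] [T1Space E] : SeparatingDual 𝕜 E where
  exists_ne_zero' x hx := by
    have : ContinuousSMul ℝ E := IsScalarTower.continuousSMul 𝕜
    obtain ⟨ξ, hξ⟩ := RCLike.geometric_hahn_banach_point_point (𝕜 := 𝕜) hx
    exact ⟨ξ, fun h => by simp [h] at hξ⟩

variable {𝕜 : Type*} [RCLike 𝕜] {𝔤 : Type*} [LieRing 𝔤] [LieAlgebra 𝕜 𝔤] {N : ℕ}

section GroupLaw

theorem bch_zero_left (hN : 1 ≤ N) (x : 𝔤) : bch 𝕜 N 0 x = x := by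
  rw [bch_of_lie_eq_zero hN (zero_lie x), zero_add]

theorem bch_zero_right (hN : 1 ≤ N) (x : 𝔤) : bch 𝕜 N x 0 = x := by
  rw [bch_of_lie_eq_zero hN (lie_zero x), add_zero]

theorem bch_smul_smul (hN : 1 ≤ N) (s t : 𝕜) (x : 𝔤) :
    bch 𝕜 N (s • x) (t • x) = (s + t) • x := by
  rw [bch_of_lie_eq_zero hN (by simp), add_smul]

theorem bch_neg_neg (V : LieFiltration 𝕜 𝔤 N) (hN : 1 ≤ N) (x y : 𝔤) :
    bch 𝕜 N (-y) (-x) = -bch 𝕜 N x y := by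
  let _ := bchGroup V hN
  exact (mul_inv_rev x y).symm

theorem bch_neg_bch_neg (V : LieFiltration 𝕜 𝔤 N) (hN : 1 ≤ N) (x y z : 𝔤) :
    bch 𝕜 N (-y) (bch 𝕜 N (-x) z) = bch 𝕜 N (-bch 𝕜 N x y) z := by
  rw [← bch_neg_neg V hN, bch_assoc V]

/-- The curve `t ↦ (-tx) ∗ y`, the orbit of `y` under the left translations that define `λ̇(x)`. -/
def leftFlow (𝕜 : Type*) [RCLike 𝕜] {𝔤 : Type*} [LieRing 𝔤] [LieAlgebra 𝕜 𝔤] (N : ℕ) (x y : 𝔤)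
    (t : 𝕜) : 𝔤 :=
  bch 𝕜 N (-(t • x)) y

theorem leftFlow_zero (hN : 1 ≤ N) (x y : 𝔤) : leftFlow 𝕜 N x y 0 = y := by
  rw [leftFlow, zero_smul, neg_zero, bch_zero_left hN]

theorem leftFlow_leftFlow (V : LieFiltration 𝕜 𝔤 N) (hN : 1 ≤ N) (s t : 𝕜) (x y : 𝔤) :
    leftFlow 𝕜 N x (leftFlow 𝕜 N x y t) s = leftFlow 𝕜 N x y (t + s) := by
  rw [leftFlow, leftFlow, leftFlow, bch_neg_bch_neg V hN, bch_smul_smul hN]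

end GroupLaw

variable [TopologicalSpace 𝔤] [IsTopologicalAddGroup 𝔤] [ContinuousLieBracket 𝔤]

section LeftTranslation

variable [ContinuousConstSMul 𝕜 𝔤]

theorem leftReg_apply (N : ℕ) (x : 𝔤) (φ : ContFun 𝕜 𝔤) (y : 𝔤) :
    leftReg 𝕜 N x φ y = φ (bch 𝕜 N (-x) y) := rfl

theorem leftReg_bch (V : LieFiltration 𝕜 𝔤 N) (hN : 1 ≤ N) (x y : 𝔤) (φ : ContFun 𝕜 𝔤) :
    leftReg 𝕜 N (bch 𝕜 N x y) φ = leftReg 𝕜 N x (leftReg 𝕜 N y φ) :=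
  ContFun.ext fun z => by simp only [leftReg_apply, bch_neg_bch_neg V hN]

theorem leftReg_functional_mem_FG (N : ℕ) (x : 𝔤) (ξ : 𝔤 →L[𝕜] 𝕜) :
    leftReg 𝕜 N x (ContFun.mk ξ ξ.continuous) ∈ FG 𝕜 𝔤 N :=
  Submodule.le_topologicalClosure _ (Submodule.subset_span ⟨x, ξ, rfl⟩)

theorem functional_mem_FG (hN : 1 ≤ N) (ξ : 𝔤 →L[𝕜] 𝕜) :
    ContFun.mk ξ ξ.continuous ∈ FG 𝕜 𝔤 N := by
  convert leftReg_functional_mem_FG N 0 ξ using 1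
  exact ContFun.ext fun y => by simp [leftReg_apply, bch_zero_left hN]

theorem const_mem_FG [SeparatingDual 𝕜 𝔤] (hN : 1 ≤ N) {z : 𝔤} (hz : z ≠ 0)
    (hcomm : ∀ y : 𝔤, ⁅z, y⁆ = 0) (a : 𝕜) :
    ContFun.mk (fun _ : 𝔤 => a) continuous_const ∈ FG 𝕜 𝔤 N := by
  obtain ⟨ξ, hξ⟩ := SeparatingDual.exists_ne_zero (R := 𝕜) hz
  -- for central `z`, the function `ξ - λ(z)ξ` is the constant `ξ z`
  have h := Submodule.smul_mem _ (a / ξ z)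
    (Submodule.add_mem _ (functional_mem_FG hN ξ)
      (Submodule.smul_mem _ (-1) (leftReg_functional_mem_FG N z ξ)))
  convert h using 1
  refine ContFun.ext fun y => ?_
  rw [ContFun.smul_apply, ContFun.add_apply, ContFun.smul_apply, leftReg_apply,
    bch_of_lie_eq_zero hN (by rw [neg_lie, hcomm, neg_zero])]
  simp [hξ]

end LeftTranslation

variable [ContinuousSMul 𝕜 𝔤]

theorem continuous_leftReg (N : ℕ) (x : 𝔤) : Continuous (leftReg 𝕜 N x) := by
  refine continuous_iff_continuousAt.mpr fun φ => ContFun.tendsto_iff.mpr fun B hB => ?_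
  have hb : Bornology.IsVonNBounded 𝕜 (Set.range fun y : B => bch 𝕜 N (-x) (y : 𝔤)) :=
    isVonNBounded_range_bch (f := fun _ : B => -x)
      ((Bornology.isVonNBounded_singleton (-x)).subset Set.range_const_subset) (by simpa using hB) N
  exact ((ContFun.tendsto_iff.mp tendsto_id _ hb).comp (bch 𝕜 N (-x))).mono
    fun y hy => ⟨⟨y, hy⟩, rfl⟩

theorem leftReg_mem_FG (V : LieFiltration 𝕜 𝔤 N) (hN : 1 ≤ N) (x : 𝔤) {φ : ContFun 𝕜 𝔤}
    (hφ : φ ∈ FG 𝕜 𝔤 N) : leftReg 𝕜 N x φ ∈ FG 𝕜 𝔤 N := by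
  have hclosed : IsClosed ((FG 𝕜 𝔤 N).comap (leftReg 𝕜 N x) : Set (ContFun 𝕜 𝔤)) :=
    (Submodule.isClosed_topologicalClosure _).preimage (continuous_leftReg N x)
  refine (Submodule.topologicalClosure_minimal _ (Submodule.span_le.mpr ?_) hclosed) hφ
  rintro _ ⟨y, ξ, rfl⟩
  rw [SetLike.mem_coe, Submodule.mem_comap, ← leftReg_bch V hN]
  exact leftReg_functional_mem_FG N _ ξ

theorem comp_mem_polyCurve_of_mem_FG (V : LieFiltration 𝕜 𝔤 N) (hN : 1 ≤ N)
    {φ : ContFun 𝕜 𝔤} (hφ : φ ∈ FG 𝕜 𝔤 N) {n : ℕ} {c : 𝕜 → 𝔤} (hc : c ∈ polyCurve 𝕜 𝔤 n) :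
    (fun t => φ (c t)) ∈ polyCurve 𝕜 𝕜 (N * n) := by
  let S : Submodule 𝕜 (ContFun 𝕜 𝔤) :=
    { carrier := {φ | (fun t => φ (c t)) ∈ polyCurve 𝕜 𝕜 (N * n)}
      add_mem' := fun ha hb => (polyCurve 𝕜 𝕜 (N * n)).add_mem ha hb
      zero_mem' := (polyCurve 𝕜 𝕜 (N * n)).zero_mem
      smul_mem' := fun a _ h => (polyCurve 𝕜 𝕜 (N * n)).smul_mem a h }
  refine (Submodule.topologicalClosure_minimal (t := S) _ (Submodule.span_le.mpr ?_) ?_) hφ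
  · rintro _ ⟨x, ξ, rfl⟩
    exact map_mem_polyCurve ξ.toLinearMap
      (V.bch_mem_polyCurve hN (const_mem_polyCurve (𝕜 := 𝕜) n (-x)) hc)
  -- Lagrange interpolation expresses membership in `S` by pointwise linear equations
  · have hS : (S : Set (ContFun 𝕜 𝔤)) = ⋂ t : 𝕜, {φ | φ (c t) = ∑ i ∈ Finset.range (N * n + 1),
        (lagrangeNat 𝕜 (N * n) i).eval t • φ (c i)} := by
      ext φ
      simp only [Set.mem_iInter]
      exact mem_polyCurve_iff
    rw [hS]
    exact isClosed_iInter fun t => isClosed_eq (ContFun.continuous_eval _)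
      (continuous_finsetSum _ fun i _ => continuous_const.mul (ContFun.continuous_eval (c i)))

theorem FG_le_contPoly (V : LieFiltration 𝕜 𝔤 N) (hN : 1 ≤ N) :
    FG 𝕜 𝔤 N ≤ ContPoly 𝕜 𝔤 N := fun φ hφ =>
  mem_contPoly_of_isLinePoly fun x v => by
    simpa using comp_mem_polyCurve_of_mem_FG V hN hφ (line_mem_polyCurve x v)

theorem isLinePoly_bch_of_mem_FG (V : LieFiltration 𝕜 𝔤 N) (hN : 1 ≤ N)
    {φ : ContFun 𝕜 𝔤} (hφ : φ ∈ FG 𝕜 𝔤 N) :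
    IsLinePoly 𝕜 (N * N) fun p : 𝔤 × 𝔤 => φ (bch 𝕜 N (-p.1) p.2) := fun p q => by
  have hneg : (fun t : 𝕜 => -(p.1 + t • q.1)) ∈ polyCurve 𝕜 𝔤 1 :=
    Submodule.neg_mem _ (line_mem_polyCurve p.1 q.1)
  simpa using! comp_mem_polyCurve_of_mem_FG V hN hφ
    (V.bch_mem_polyCurve hN hneg (line_mem_polyCurve p.2 q.2))

end ClosedSpan

/-! ### The representations -/

theorem exists_ne_zero_forall_lie_eq_zero {R L : Type*} [CommRing R] [LieRing L] [LieAlgebra R L]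
    {k : ℕ} (hne : LieModule.lowerCentralSeries R L L k ≠ ⊥)
    (heq : LieModule.lowerCentralSeries R L L (k + 1) = ⊥) :
    ∃ z : L, z ≠ 0 ∧ ∀ y : L, ⁅z, y⁆ = 0 := by
  obtain ⟨z, hz, hz0⟩ := not_forall₂.mp (mt (LieSubmodule.eq_bot_iff _).mpr hne)
  refine ⟨z, hz0, fun y => ?_⟩
  have hmem : ⁅y, z⁆ ∈ LieModule.lowerCentralSeries R L L (k + 1) := by
    rw [LieModule.lowerCentralSeries_succ]
    exact LieSubmodule.lie_mem_lie (LieSubmodule.mem_top y) hz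
  rw [heq, LieSubmodule.mem_bot] at hmem
  rw [← lie_skew, hmem, neg_zero]

theorem hasDerivAt_sum_inv_factorial_mul_pow_mul {𝕜 : Type*} [NontriviallyNormedField 𝕜]
    {g : ℕ → 𝕜 → 𝕜} {g' : ℕ → 𝕜} (hg : ∀ n, HasDerivAt (g n) (g' n) 0) {M : ℕ} (hM : 2 ≤ M) :
    HasDerivAt (fun t => ∑ n ∈ Finset.range M, (n.factorial : 𝕜)⁻¹ * t ^ n * g n t)
      (g 1 0 + g' 0) 0 := by
  have h := HasDerivAt.fun_sum (u := Finset.range M) fun n _ =>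
    ((hasDerivAt_pow n (0 : 𝕜)).const_mul (n.factorial : 𝕜)⁻¹).mul (hg n)
  obtain ⟨m, rfl⟩ := Nat.exists_eq_add_of_le' hM
  rw [Finset.sum_range_succ', Finset.sum_range_succ',
    Finset.sum_eq_zero fun n _ => by simp] at h
  simpa using! h

section Representation

open Polynomial

variable {𝕜 : Type v} [RCLike 𝕜] {𝔤 : Type u} [LieRing 𝔤] [LieAlgebra 𝕜 𝔤] [TopologicalSpace 𝔤]
  [IsTopologicalAddGroup 𝔤] [ContinuousSMul 𝕜 𝔤] [ContinuousLieBracket 𝔤] {N : ℕ}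

theorem FG_ext {φ ψ : FG 𝕜 𝔤 N} (h : ∀ y, (φ : ContFun 𝕜 𝔤) y = (ψ : ContFun 𝕜 𝔤) y) : φ = ψ :=
  Subtype.ext (ContFun.ext h)

/-- Evaluation at a point, as a linear form on `F_G`. -/
def evalFG (𝕜 : Type v) [RCLike 𝕜] {𝔤 : Type u} [LieRing 𝔤] [LieAlgebra 𝕜 𝔤] [TopologicalSpace 𝔤]
    [IsTopologicalAddGroup 𝔤] [ContinuousSMul 𝕜 𝔤] [ContinuousLieBracket 𝔤] (N : ℕ) (y : 𝔤) :
    FG 𝕜 𝔤 N →ₗ[𝕜] 𝕜 where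
  toFun φ := (φ : ContFun 𝕜 𝔤) y
  map_add' _ _ := rfl
  map_smul' _ _ := rfl

theorem evalFG_apply (φ : FG 𝕜 𝔤 N) (y : 𝔤) : evalFG 𝕜 N y φ = (φ : ContFun 𝕜 𝔤) y := rfl

theorem isLinePoly_FG_of_eval {E : Type*} [AddCommGroup E] [Module 𝕜 E] {D : ℕ}
    {f : E → FG 𝕜 𝔤 N} (h : ∀ y, IsLinePoly 𝕜 D fun x => (f x : ContFun 𝕜 𝔤) y) :
    IsLinePoly 𝕜 D f := fun x v => mem_polyCurve_iff.mpr fun t => FG_ext fun y => by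
  rw [(h y).apply_add_smul x v t, ← evalFG_apply (∑ i ∈ _, _), map_sum]
  simp only [map_smul, evalFG_apply]

variable (V : LieFiltration 𝕜 𝔤 N) (hN : 1 ≤ N)

/-- The operator `λ(x)` on `F_G`. -/
noncomputable def lamFG (x : 𝔤) : FG 𝕜 𝔤 N →L[𝕜] FG 𝕜 𝔤 N where
  toLinearMap := (leftReg 𝕜 N x).restrict fun _ => leftReg_mem_FG V hN x
  cont := ((continuous_leftReg N x).comp continuous_subtype_val).subtype_mk _

theorem lamFG_apply (x : 𝔤) (φ : FG 𝕜 𝔤 N) (y : 𝔤) :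
    (lamFG V hN x φ : ContFun 𝕜 𝔤) y = (φ : ContFun 𝕜 𝔤) (bch 𝕜 N (-x) y) := rfl

theorem lamFG_bch (x y : 𝔤) : lamFG V hN (bch 𝕜 N x y) = lamFG V hN x * lamFG V hN y :=
  ContinuousLinearMap.ext fun φ => Subtype.ext (leftReg_bch V hN x y φ)

theorem lamFG_zero : lamFG V hN 0 = 1 :=
  ContinuousLinearMap.ext fun φ => FG_ext fun y => by
    rw [lamFG_apply, neg_zero, bch_zero_left hN]; rfl

theorem lamFG_injective [SeparatingDual 𝕜 𝔤] : Function.Injective (lamFG V hN) := by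
  intro x y h
  by_contra hne
  obtain ⟨ξ, hξ⟩ := SeparatingDual.exists_separating_of_ne (R := 𝕜) hne
  have hval := congrArg (fun T : FG 𝕜 𝔤 N →L[𝕜] FG 𝕜 𝔤 N =>
    (T ⟨_, functional_mem_FG hN ξ⟩ : ContFun 𝕜 𝔤) 0) h
  simp only [lamFG_apply, bch_zero_right hN, ContFun.mk_apply, map_neg, neg_inj] at hval
  exact hξ hval

section Smoothness

variable (φ : FG 𝕜 𝔤 N)

theorem isLinePoly_lamFG_eval (y : 𝔤) :
    IsLinePoly 𝕜 (N * N) fun x => (lamFG V hN x φ : ContFun 𝕜 𝔤) y := by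
  simpa [lamFG_apply] using
    (isLinePoly_bch_of_mem_FG V hN φ.2).comp_linear (LinearMap.inl 𝕜 𝔤 𝔤) (0, y)

theorem isLinePoly_lamFG : IsLinePoly 𝕜 (N * N) fun x => lamFG V hN x φ :=
  isLinePoly_FG_of_eval (isLinePoly_lamFG_eval V hN φ)

theorem continuous_lamFG : Continuous fun x => lamFG V hN x φ := by
  have h : Continuous fun x => leftReg 𝕜 N x (φ : ContFun 𝕜 𝔤) :=
    ContFun.continuous_of_isLinePoly
      ((φ : ContFun 𝕜 𝔤).continuous.comp (continuous_bch continuous_fst.neg continuous_snd N))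
      (isLinePoly_bch_of_mem_FG V hN φ.2)
  exact continuous_induced_rng.mpr h

include V hN in
theorem continuous_smul_FG : Continuous fun t : 𝕜 => t • φ := by
  refine Continuous.subtype_mk (ContFun.continuous_of_isLinePoly (D := 1 + N * 1)
    (h := fun t : 𝕜 => t • (φ : ContFun 𝕜 𝔤))
    (continuous_fst.mul ((φ : ContFun 𝕜 𝔤).continuous.comp continuous_snd)) fun p q => ?_) _
  exact map₂_mem_polyCurve (LinearMap.mul 𝕜 𝕜) (line_mem_polyCurve p.1 q.1)
    (comp_mem_polyCurve_of_mem_FG V hN φ.2 (line_mem_polyCurve p.2 q.2))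

theorem isSmoothMap_lamFG : IsSmoothMap 𝕜 fun x => lamFG V hN x φ := fun k =>
  (isLinePoly_lamFG V hN φ).isCk (continuous_smul_FG V hN) k (continuous_lamFG V hN φ)

end Smoothness

section Unipotence

include V hN in
theorem exists_polynomial_leftFlow (φ : FG 𝕜 𝔤 N) (x y : 𝔤) : ∃ P : 𝕜[X],
    P.natDegree ≤ N * N ∧ ∀ t, (φ : ContFun 𝕜 𝔤) (leftFlow 𝕜 N x y t) = P.eval t := by
  simpa [lamFG_apply] using! exists_polynomial_of_mem_polyCurve (isLinePoly_lamFG_eval V hN φ y 0 x)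

theorem lamFG_sub_one_pow_leftFlow {φ : FG 𝕜 𝔤 N} {x y : 𝔤} {f : 𝕜 → 𝕜}
    (hf : ∀ t, (φ : ContFun 𝕜 𝔤) (leftFlow 𝕜 N x y t) = f t) (n : ℕ) (t : 𝕜) :
    (((lamFG V hN x - 1) ^ n) φ : ContFun 𝕜 𝔤) (leftFlow 𝕜 N x y t) = ((fwdDiff 1)^[n] f) t := by
  induction n generalizing t with
  | zero => simpa using hf t
  | succ n ih =>
    have hstep : leftFlow 𝕜 N x y (t + 1) = bch 𝕜 N (-x) (leftFlow 𝕜 N x y t) := by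
      rw [← leftFlow_leftFlow V hN, leftFlow, one_smul]
    rw [pow_succ', mul_apply_eq_comp, Function.iterate_succ_apply', fwdDiff, ← ih, ← ih, hstep,
      sub_apply, one_apply_eq_self, ← evalFG_apply (_ - _), map_sub]
    rfl

theorem lamFG_sub_one_pow_eq_zero {n : ℕ} (hn : N * N < n) (x : 𝔤) :
    (lamFG V hN x - 1) ^ n = 0 := by
  refine ContinuousLinearMap.ext fun φ => FG_ext fun y => ?_
  obtain ⟨P, hP, hPe⟩ := exists_polynomial_leftFlow V hN φ x y
  have h := lamFG_sub_one_pow_leftFlow V hN (f := P.eval) hPe n 0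
  rwa [fwdDiff_iter_eq_zero_of_degree_lt (hP.trans_lt hn), leftFlow_zero hN] at h

end Unipotence

section Derivative

/-- The operator `λ̇(x)` on `F_G`, as a linear function of `x`; the derivative of `t ↦ λ(tx)` at
`0` is expressed through the values `λ(ix)`, `i = 0, …, N²`. -/
noncomputable def dlamFG : 𝔤 →ₗ[𝕜] (FG 𝕜 𝔤 N →L[𝕜] FG 𝕜 𝔤 N) where
  toFun x := ∑ i ∈ Finset.range (N * N + 1), diffWeight 𝕜 (N * N) i • lamFG V hN ((i : 𝕜) • x)
  map_add' x x' := ContinuousLinearMap.ext fun φ => FG_ext fun y => by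
    have h := (isLinePoly_lamFG_eval V hN φ y).lineDer_add x x' 0
    simp only [lineDer, zero_add] at h
    simp only [← evalFG_apply, add_apply, sum_apply, smul_apply, map_add, map_sum, map_smul] at h ⊢
    exact h
  map_smul' a x := ContinuousLinearMap.ext fun φ => FG_ext fun y => by
    have h := (isLinePoly_lamFG_eval V hN φ y).lineDer_smul a x 0
    simp only [lineDer, zero_add] at h
    simp only [← evalFG_apply, sum_apply, RingHom.id_apply, smul_apply, map_sum, map_smul] at h ⊢
    exact h

theorem dlamFG_eq_sum (x : 𝔤) : dlamFG V hN x =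
    ∑ i ∈ Finset.range (N * N + 1), diffWeight 𝕜 (N * N) i • lamFG V hN ((i : 𝕜) • x) := rfl

theorem dlamFG_apply (x : 𝔤) (φ : FG 𝕜 𝔤 N) (y : 𝔤) :
    (dlamFG V hN x φ : ContFun 𝕜 𝔤) y = ∑ i ∈ Finset.range (N * N + 1),
      diffWeight 𝕜 (N * N) i • (φ : ContFun 𝕜 𝔤) (leftFlow 𝕜 N x y i) := by
  simp only [← evalFG_apply, dlamFG_eq_sum, sum_apply, smul_apply, map_sum, map_smul]
  rfl

theorem tendsto_slope_lamFG (x : 𝔤) (φ : FG 𝕜 𝔤 N) :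
    Tendsto (fun t : 𝕜 => t⁻¹ • (lamFG V hN (t • x) φ - φ)) (𝓝[≠] 0) (𝓝 (dlamFG V hN x φ)) := by
  have h := tendsto_slope_polyCurve (continuous_smul_FG V hN) (isLinePoly_lamFG V hN φ 0 x)
  simp only [zero_add, zero_smul, lamFG_zero, one_apply_eq_self] at h
  simpa only [dlamFG_eq_sum, sum_apply, smul_apply] using h

theorem hasDerivAt_leftFlow (x : 𝔤) (φ : FG 𝕜 𝔤 N) (y : 𝔤) :
    HasDerivAt (fun t => (φ : ContFun 𝕜 𝔤) (leftFlow 𝕜 N x y t))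
      ((dlamFG V hN x φ : ContFun 𝕜 𝔤) y) 0 := by
  have h := (isLinePoly_lamFG_eval V hN φ y).hasDerivAt 0 x
  simpa only [lineDer, zero_add, lamFG_apply, dlamFG_apply] using! h

theorem isLambdaDot_dlamFG (x : 𝔤) (φ : FG 𝕜 𝔤 N) :
    IsLambdaDot 𝕜 N x φ (dlamFG V hN x φ : ContFun 𝕜 𝔤) := fun y => by
  have h := hasDerivAt_iff_tendsto_slope_zero.mp (hasDerivAt_leftFlow V hN x φ y)
  simp only [zero_add, leftFlow_zero hN] at h
  refine h.congr fun t => ?_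
  rw [smul_eq_mul, div_eq_inv_mul, leftFlow]

theorem dlamFG_functional_apply_zero (ξ : 𝔤 →L[𝕜] 𝕜) (x : 𝔤) :
    (dlamFG V hN x ⟨_, functional_mem_FG hN ξ⟩ : ContFun 𝕜 𝔤) 0 = -ξ x := by
  refine (hasDerivAt_leftFlow V hN x ⟨_, functional_mem_FG hN ξ⟩ 0).unique ?_
  simp only [leftFlow, bch_zero_right hN, ContFun.mk_apply, map_neg, map_smul, smul_eq_mul]
  simpa using ((hasDerivAt_id (0 : 𝕜)).mul_const (ξ x)).fun_neg

theorem dlamFG_injective [SeparatingDual 𝕜 𝔤] : Function.Injective (dlamFG V hN) := by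
  intro x y h
  by_contra hne
  obtain ⟨ξ, hξ⟩ := SeparatingDual.exists_separating_of_ne (R := 𝕜) hne
  have hval := dlamFG_functional_apply_zero V hN ξ x
  rw [h, dlamFG_functional_apply_zero, neg_inj] at hval
  exact hξ hval.symm

theorem dlamFG_leftFlow {φ : FG 𝕜 𝔤 N} {x y : 𝔤} {P : 𝕜[X]}
    (hP : ∀ t, (φ : ContFun 𝕜 𝔤) (leftFlow 𝕜 N x y t) = P.eval t) (t : 𝕜) :
    (dlamFG V hN x φ : ContFun 𝕜 𝔤) (leftFlow 𝕜 N x y t) = (derivative P).eval t := by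
  refine (hasDerivAt_leftFlow V hN x φ _).unique ?_
  simp only [leftFlow_leftFlow V hN, hP]
  exact HasDerivAt.comp_const_add t 0 (by simpa using P.hasDerivAt t)

theorem dlamFG_pow_leftFlow {φ : FG 𝕜 𝔤 N} {x y : 𝔤} {P : 𝕜[X]}
    (hP : ∀ t, (φ : ContFun 𝕜 𝔤) (leftFlow 𝕜 N x y t) = P.eval t) (n : ℕ) (t : 𝕜) :
    ((dlamFG V hN x ^ n) φ : ContFun 𝕜 𝔤) (leftFlow 𝕜 N x y t) = (derivative^[n] P).eval t := by
  induction n generalizing t with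
  | zero => simpa using hP t
  | succ n ih =>
    rw [pow_succ', mul_apply_eq_comp, Function.iterate_succ_apply', dlamFG_leftFlow V hN ih]

theorem dlamFG_pow_eq_zero {n : ℕ} (hn : N * N < n) (x : 𝔤) : dlamFG V hN x ^ n = 0 := by
  refine ContinuousLinearMap.ext fun φ => FG_ext fun y => ?_
  obtain ⟨P, hP, hPe⟩ := exists_polynomial_leftFlow V hN φ x y
  have h := dlamFG_pow_leftFlow V hN hPe n 0
  rwa [iterate_derivative_eq_zero (hP.trans_lt hn), leftFlow_zero hN, eval_zero] at h

end Derivative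

section Bracket

theorem lamFG_mul_lamFG_smul (x y : 𝔤) (s : 𝕜) : lamFG V hN x * lamFG V hN (s • y)
    = lamFG V hN (s • expAd 𝕜 (2 * (N + 1) + 1) x y) * lamFG V hN x := by
  have hsmul : s • expAd 𝕜 (2 * (N + 1) + 1) x y = expAd 𝕜 (2 * (N + 1) + 1) x (s • y) := by
    simp only [expAd, Finset.smul_sum, map_smul]
    exact Finset.sum_congr rfl fun n _ => smul_comm _ _ _
  rw [hsmul, ← bch_conj V, ← lamFG_bch, ← lamFG_bch, bch_assoc V,
    bch_of_lie_eq_zero hN (x := -x) (y := x) (by simp), neg_add_cancel, bch_zero_right hN]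

theorem lamFG_mul_dlamFG (x y : 𝔤) : lamFG V hN x * dlamFG V hN y
    = dlamFG V hN (expAd 𝕜 (2 * (N + 1) + 1) x y) * lamFG V hN x := by
  refine ContinuousLinearMap.ext fun φ => ?_
  simp only [dlamFG_eq_sum, mul_apply_eq_comp, sum_apply, smul_apply, map_sum, map_smul]
  exact Finset.sum_congr rfl fun i _ =>
    congrArg _ (DFunLike.congr_fun (lamFG_mul_lamFG_smul V hN x y i) φ)

theorem dlamFG_apply_leftFlow (x y : 𝔤) (φ : FG 𝕜 𝔤 N) (p : 𝔤) (t : 𝕜) :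
    (dlamFG V hN y φ : ContFun 𝕜 𝔤) (leftFlow 𝕜 N x p t)
      = ∑ n ∈ Finset.range (2 * (N + 1) + 1), (n.factorial : 𝕜)⁻¹ * t ^ n *
        (dlamFG V hN ((LieAlgebra.ad 𝕜 𝔤 x ^ n) y) (lamFG V hN (t • x) φ) : ContFun 𝕜 𝔤) p := by
  have h := congrArg (fun T : FG 𝕜 𝔤 N →L[𝕜] FG 𝕜 𝔤 N => evalFG 𝕜 N p (T φ))
    (lamFG_mul_dlamFG V hN (t • x) y)
  simp only [mul_apply_eq_comp, expAd, map_sum, map_smul, _root_.smul_pow, LinearMap.smul_apply,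
    sum_apply, smul_apply, smul_smul, smul_eq_mul] at h
  exact h

theorem hasDerivAt_dlamFG_lamFG (x z : 𝔤) (φ : FG 𝕜 𝔤 N) (p : 𝔤) :
    HasDerivAt (fun t : 𝕜 => (dlamFG V hN z (lamFG V hN (t • x) φ) : ContFun 𝕜 𝔤) p)
      ((dlamFG V hN z (dlamFG V hN x φ) : ContFun 𝕜 𝔤) p) 0 := by
  simp only [dlamFG_apply V hN z]
  exact HasDerivAt.fun_sum fun i _ => (hasDerivAt_leftFlow V hN x φ _).fun_const_smul _

theorem dlamFG_lie (x y : 𝔤) :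
    dlamFG V hN ⁅x, y⁆ = dlamFG V hN x * dlamFG V hN y - dlamFG V hN y * dlamFG V hN x := by
  refine ContinuousLinearMap.ext fun φ => FG_ext fun p => ?_
  -- differentiate `λ(tx) λ̇(y) = λ̇(exp(t ad x) y) λ(tx)` at `t = 0`
  have hright := hasDerivAt_sum_inv_factorial_mul_pow_mul
    (fun n => hasDerivAt_dlamFG_lamFG V hN x ((LieAlgebra.ad 𝕜 𝔤 x ^ n) y) φ p)
    (M := 2 * (N + 1) + 1) (by lia)
  simp only [← dlamFG_apply_leftFlow] at hright
  have h := (hasDerivAt_leftFlow V hN x (dlamFG V hN y φ) p).unique hright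
  simp only [zero_smul, lamFG_zero, one_apply_eq_self, pow_one, pow_zero, Module.End.one_apply,
    LieAlgebra.ad_apply] at h
  rw [sub_apply, ← evalFG_apply (_ - _), map_sub, evalFG_apply, evalFG_apply, mul_apply_eq_comp,
    mul_apply_eq_comp, h, add_sub_cancel_right]

end Bracket

end Representation

theorem theorem2p13 {𝕜 : Type v} [RCLike 𝕜] {𝔤 : Type u} [LieRing 𝔤] [LieAlgebra 𝕜 𝔤]
    [TopologicalSpace 𝔤] [IsTopologicalAddGroup 𝔤] [ContinuousSMul 𝕜 𝔤]
    [Module ℝ 𝔤] [IsScalarTower ℝ 𝕜 𝔤] [LocallyConvexSpace ℝ 𝔤] [T2Space 𝔤]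
    [ContinuousLieBracket 𝔤] (N : ℕ) (hN : 1 ≤ N)
    (hN_ne : LieModule.lowerCentralSeries 𝕜 𝔤 𝔤 (N - 1) ≠ ⊥)
    (hN_eq : LieModule.lowerCentralSeries 𝕜 𝔤 𝔤 N = ⊥) :
    -- (i) the function space
    (IsClosed (FG 𝕜 𝔤 N : Set (ContFun 𝕜 𝔤)) ∧
      FG 𝕜 𝔤 N ≤ ContPoly 𝕜 𝔤 N ∧
      (∀ x : 𝔤, ∀ φ ∈ FG 𝕜 𝔤 N, leftReg 𝕜 N x φ ∈ FG 𝕜 𝔤 N) ∧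
      ∀ c : 𝕜, ContFun.mk (fun _ : 𝔤 => c) continuous_const ∈ FG 𝕜 𝔤 N) ∧
    ∃ _ : Group 𝔤, (∀ x y : 𝔤, x * y = bch 𝕜 N x y) ∧
      -- (ii) the group representation
      ∃ lam : 𝔤 →* (FG 𝕜 𝔤 N →L[𝕜] FG 𝕜 𝔤 N),
        (∀ (x : 𝔤) (φ : FG 𝕜 𝔤 N), (lam x φ : ContFun 𝕜 𝔤) = leftReg 𝕜 N x φ) ∧
        Function.Injective lam ∧
        (∀ φ : FG 𝕜 𝔤 N, IsSmoothMap 𝕜 fun x : 𝔤 => lam x φ) ∧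
        (∀ x : 𝔤, (lam x - 1) ^ (2 ^ (N - 1) * N + 1) = 0) ∧
        -- (iii) the derived representation
        ∃ dlam : 𝔤 →ₗ[𝕜] (FG 𝕜 𝔤 N →L[𝕜] FG 𝕜 𝔤 N),
          (∀ x y : 𝔤, dlam ⁅x, y⁆ = dlam x * dlam y - dlam y * dlam x) ∧
          (∀ (x : 𝔤) (φ : FG 𝕜 𝔤 N), IsLambdaDot 𝕜 N x φ (dlam x φ : ContFun 𝕜 𝔤)) ∧
          (∀ (x : 𝔤) (φ : FG 𝕜 𝔤 N),
            Tendsto (fun t : 𝕜 => t⁻¹ • (lam (t • x) φ - φ)) (𝓝[≠] 0) (𝓝 (dlam x φ))) ∧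
          Function.Injective dlam ∧
          ∀ x : 𝔤, dlam x ^ (2 ^ (N - 1) * N + 1) = 0 := by
  have V := LieFiltration.ofLowerCentralSeries hN_eq
  have : SeparatingDual 𝕜 𝔤 := separatingDual_of_locallyConvexSpace 𝕜 𝔤
  obtain ⟨z, hz, hcomm⟩ :=
    exists_ne_zero_forall_lie_eq_zero hN_ne (by rwa [Nat.sub_add_cancel hN])
  have hdeg : N * N < 2 ^ (N - 1) * N + 1 :=
    Nat.lt_succ_of_le (Nat.mul_le_mul_right N (Nat.le_of_pred_lt Nat.lt_two_pow_self))
  refine ⟨⟨Submodule.isClosed_topologicalClosure _, FG_le_contPoly V hN,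
    fun x φ hφ => leftReg_mem_FG V hN x hφ, const_mem_FG hN hz hcomm⟩,
    bchGroup V hN, fun _ _ => rfl, ?_⟩
  let _ : Group 𝔤 := bchGroup V hN
  exact ⟨{ toFun := lamFG V hN, map_one' := lamFG_zero V hN, map_mul' := lamFG_bch V hN },
    fun _ _ => rfl, lamFG_injective V hN, isSmoothMap_lamFG V hN,
    lamFG_sub_one_pow_eq_zero V hN hdeg, dlamFG V hN, dlamFG_lie V hN, isLambdaDot_dlamFG V hN,
    tendsto_slope_lamFG V hN, dlamFG_injective V hN, dlamFG_pow_eq_zero V hN hdeg⟩
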